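/- **Setting.** Let $n\ge 1$, $m\ge 0$. A structured matrix is a matrix each of whose entries is either a fixed zero or a free parameter (a "nonzero entry") that takes arbitrary real values independently of the other entries; a realization assigns real values to the free parameters. Let $A$ and $B$ be structured matrices of sizes $n\times n$ and $n\times m$. For $k\ge 1$ put $\mathcal C_k(A,B)=[B,AB,\dots,A^{k-1}B]$, and let $\mathrm{gk}\,\mathcal C_k(A,B)$ be its generic rank, i.e. its maximum rank over all realizations of $(A,B)$. The structural controllability index is $$\mu(A,B)=\min\{k\in\{1,\dots,n\}:\ \mathrm{gk}\,\mathcal C_k(A,B)=\mathrm{gk}\,\mathcal C_{k+1}(A,B)\}.$$ The system digraph $\mathcal G(A,B)$ has the state nodes $x_1,\dots,x_n$ and the input nodes $u_1,\dots,u_m$, an edge $(x_i,x_j)$ whenever $A_{ji}$ is a nonzero entry, and an edge $(u_i,x_j)$ whenever $B_{ji}$ is a nonzero entry. A path is a finite nonempty sequence of consecutive edges; a cycle is a path whose start and end nodes coincide and in which no other node is repeated (self-loops are cycles); a stem is a path without repeated nodes from an input node to a state node. "Disjoint" means vertex-disjoint. Cactus structures of $\mathcal G(A,B)$ are defined recursively: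 a stem is a cactus structure; and a cactus structure together with a cycle disjoint from it and a path that starts at a node of the former cactus structure, ends at a node of the cycle, and shares no edge with the former cactus structure, is also a cactus structure. The state nodes essentially covered by a cactus structure are those lying in its stem or in one of the cycles used in its construction. A cactus structure family is a finite (possibly empty) collection of pairwise disjoint cactus structures. It is maximum if the sum of the numbers of state nodes essentially covered by its members is largest among all cactus structure families; this largest value is denoted $|\mathcal G(A,B)|_{es}$. **Theorem.** Let $(A,B)$ be as above (not necessarily structurally controllable). 1. Let $k\ge 1$ be an integer. If there is a maximum cactus structure family of $\mathcal G(A,B)$ each of whose cactus structures essentially covers at most $k$ state nodes, then $\mu(A,B)\le k$. 2. If $m=1$ and $B$ has at least one nonzero entry, then $\mu(A,B)=|\mathcal G(A,B)|_{es}$. -/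

import Mathlib

/-- A structured matrix of size `r × c`: `P i j` says that the `(i, j)` entry is a free parameter
(a "nonzero entry"); all other entries are fixed zeros. -/
def StructuredMatrix (r c : ℕ) : Type := Fin r → Fin c → Prop

/-- `M` is a realization of `P`: the fixed zeros are zero, the free parameters take arbitrary
real values. -/
def StructuredMatrix.IsRealization {r c : ℕ} (P : StructuredMatrix r c)
    (M : Matrix (Fin r) (Fin c) ℝ) : Prop :=
  ∀ i j, ¬ P i j → M i j = 0

/-- The `k`-step controllability matrix `[B, A B, ..., A ^ (k - 1) B]`; its columns are indexed by
pairs (power of `A`, column of `B`). -/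
def ctrbMatrix {n m : ℕ} (k : ℕ) (A : Matrix (Fin n) (Fin n) ℝ) (B : Matrix (Fin n) (Fin m) ℝ) :
    Matrix (Fin n) (Fin k × Fin m) ℝ :=
  Matrix.of fun i p => (A ^ (p.1 : ℕ) * B) i p.2

/-- The ranks that the `k`-step controllability matrix attains over all realizations. -/
def ctrbRanks {n m : ℕ} (A : StructuredMatrix n n) (B : StructuredMatrix n m) (k : ℕ) : Set ℕ :=
  {r | ∃ (A' : Matrix (Fin n) (Fin n) ℝ) (B' : Matrix (Fin n) (Fin m) ℝ),
    A.IsRealization A' ∧ B.IsRealization B' ∧ r = (ctrbMatrix k A' B').rank}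

/-- The generic rank of the `k`-step controllability matrix: the maximum rank it attains as a
function of the free parameters of `(A, B)`. -/
noncomputable def ctrbGenericRank {n m : ℕ} (A : StructuredMatrix n n) (B : StructuredMatrix n m)
    (k : ℕ) : ℕ :=
  sSup (ctrbRanks A B k)

/-- The `k ∈ {1, ..., n}` at which the generic rank of the controllability matrix stalls. -/
def stallingSteps {n m : ℕ} (A : StructuredMatrix n n) (B : StructuredMatrix n m) : Set ℕ :=
  {k | 1 ≤ k ∧ k ≤ n ∧ ctrbGenericRank A B k = ctrbGenericRank A B (k + 1)}

/-- The structural controllability index of `(A, B)`. -/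
noncomputable def structuralControllabilityIndex {n m : ℕ} (A : StructuredMatrix n n)
    (B : StructuredMatrix n m) : ℕ :=
  sInf (stallingSteps A B)

/-- The nodes of the system digraph: state nodes `Sum.inl i` and input nodes `Sum.inr j`. -/
abbrev SysNode (n m : ℕ) : Type := Fin n ⊕ Fin m

/-- The system digraph: `x_i → x_j` if `A j i` is a nonzero entry, `u_i → x_j` if `B j i` is a
nonzero entry, and no other edges. -/
def systemDigraph {n m : ℕ} (A : StructuredMatrix n n) (B : StructuredMatrix n m) :
    Digraph (SysNode n m) where
  Adj
    | Sum.inl i, Sum.inl j => A j i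
    | Sum.inr i, Sum.inl j => B j i
    | _, Sum.inr _ => False

/-- A path, given by the list of the nodes that it visits: it has at least one edge, and
repetitions are allowed. -/
def Digraph.IsPathList {V : Type} (G : Digraph V) (p : List V) : Prop :=
  2 ≤ p.length ∧ p.IsChain G.Adj

/-- A cycle `[v₁, ..., v_k, v₁]`: a path whose start and end nodes coincide, with no other
repetition. A self-loop is `[v, v]`. -/
def Digraph.IsCycleList {V : Type} (G : Digraph V) (c : List V) : Prop :=
  G.IsPathList c ∧ c.head? = c.getLast? ∧ c.tail.Nodup

/-- The edges of the path that visits the nodes of the given list. -/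
def pathEdges {V : Type} [DecidableEq V] (p : List V) : Finset (V × V) :=
  (p.zip p.tail).toFinset

/-- A stem: a path without repeated nodes from an input node to a state node. -/
def IsStem {n m : ℕ} (A : StructuredMatrix n n) (B : StructuredMatrix n m)
    (p : List (SysNode n m)) : Prop :=
  (systemDigraph A B).IsPathList p ∧ p.Nodup ∧
    (∃ u : Fin m, p.head? = some (Sum.inr u)) ∧ (∃ x : Fin n, p.getLast? = some (Sum.inl x))

/-- `IsCactusStructure A B N E S`: there is a cactus structure of the system digraph with node set
`N`, edge set `E`, and set `S` of essentially covered state nodes, i.e. of the state nodes that lie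
in its stem or in one of its cycles. -/
inductive IsCactusStructure {n m : ℕ} (A : StructuredMatrix n n) (B : StructuredMatrix n m) :
    Finset (SysNode n m) → Finset (SysNode n m × SysNode n m) → Finset (Fin n) → Prop
  | stem (p : List (SysNode n m)) (hp : IsStem A B p) :
      IsCactusStructure A B p.toFinset (pathEdges p) p.toFinset.toLeft
  | attach (N : Finset (SysNode n m)) (E : Finset (SysNode n m × SysNode n m))
      (S : Finset (Fin n)) (former : IsCactusStructure A B N E S)
      (c : List (SysNode n m)) (hc : (systemDigraph A B).IsCycleList c)
      (hcN : Disjoint c.toFinset N)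
      (p : List (SysNode n m)) (hp : (systemDigraph A B).IsPathList p)
      (hstart : ∃ v ∈ N, p.head? = some v) (hend : ∃ w ∈ c, p.getLast? = some w)
      (hpE : Disjoint (pathEdges p) E) :
      IsCactusStructure A B (N ∪ p.toFinset ∪ c.toFinset) (E ∪ pathEdges p ∪ pathEdges c)
        (S ∪ c.toFinset.toLeft)

/-- A cactus structure of the system digraph. -/
structure CactusStructure {n m : ℕ} (A : StructuredMatrix n n) (B : StructuredMatrix n m) where
  nodes : Finset (SysNode n m)
  edges : Finset (SysNode n m × SysNode n m)
  essCovered : Finset (Fin n)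
  isCactusStructure : IsCactusStructure A B nodes edges essCovered

/-- A cactus structure family: finitely many, pairwise (vertex-)disjoint cactus structures. -/
structure CactusStructureFamily {n m : ℕ} (A : StructuredMatrix n n)
    (B : StructuredMatrix n m) where
  size : ℕ
  member : Fin size → CactusStructure A B
  disjoint : ∀ i j, i ≠ j → Disjoint (member i).nodes (member j).nodes

/-- The sum of the numbers of state nodes essentially covered by the members of a family. -/
def CactusStructureFamily.essCount {n m : ℕ} {A : StructuredMatrix n n}
    {B : StructuredMatrix n m} (F : CactusStructureFamily A B) : ℕ :=
  ∑ i, (F.member i).essCovered.card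

/-- A maximum cactus structure family. -/
def CactusStructureFamily.IsMaximum {n m : ℕ} {A : StructuredMatrix n n}
    {B : StructuredMatrix n m} (F : CactusStructureFamily A B) : Prop :=
  ∀ F' : CactusStructureFamily A B, F'.essCount ≤ F.essCount

/-- The maximum number of state nodes that a cactus structure family essentially covers. -/
noncomputable def maxEssCount {n m : ℕ} (A : StructuredMatrix n n) (B : StructuredMatrix n m) :
    ℕ :=
  sSup (Set.range (CactusStructureFamily.essCount (A := A) (B := B)))

/-- The set of attained ranks is bounded, so the supremum in `ctrbGenericRank` is a maximum. -/
theorem ctrbRanks_isGreatest {n m : ℕ} (A : StructuredMatrix n n) (B : StructuredMatrix n m)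
    (k : ℕ) : IsGreatest (ctrbRanks A B k) (ctrbGenericRank A B k) := by
  have hne : (ctrbRanks A B k).Nonempty :=
    ⟨_, 0, 0, fun _ _ _ => rfl, fun _ _ _ => rfl, rfl⟩
  have hb : BddAbove (ctrbRanks A B k) := by
    refine ⟨n, ?_⟩
    rintro r ⟨A', B', _, _, rfl⟩
    simpa using (ctrbMatrix k A' B').rank_le_card_height
  exact ⟨Nat.sSup_mem hne hb, fun r hr => le_csSup hb hr⟩

/-- By the Cayley-Hamilton theorem, the rank of the controllability matrix stalls at step `n`. -/
theorem ctrbMatrix_rank_stalls {n m : ℕ} (A : Matrix (Fin n) (Fin n) ℝ)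
    (B : Matrix (Fin n) (Fin m) ℝ) :
    (ctrbMatrix (n + 1) A B).rank = (ctrbMatrix n A B).rank := by
  rw [Matrix.rank_eq_finrank_span_cols, Matrix.rank_eq_finrank_span_cols]
  have hcol : ∀ (t : ℕ) (j : Fin m), t < n → (A ^ t * B).col j ∈
      Submodule.span ℝ (Set.range (ctrbMatrix n A B).col) := fun t j ht =>
    Submodule.subset_span ⟨(⟨t, ht⟩, j), rfl⟩
  have h : Submodule.span ℝ (Set.range (ctrbMatrix (n + 1) A B).col) =
      Submodule.span ℝ (Set.range (ctrbMatrix n A B).col) := by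
    apply le_antisymm
    · rw [Submodule.span_le]
      rintro _ ⟨⟨t, j⟩, rfl⟩
      change (A ^ (t : ℕ) * B).col j ∈ _
      rcases Nat.lt_succ_iff_lt_or_eq.mp t.2 with ht | ht
      · exact hcol t j ht
      · rw [ht]
        have hch := Matrix.aeval_self_charpoly A
        have hd : A.charpoly.natDegree = n := by simp
        rw [Polynomial.aeval_eq_sum_range, hd, Finset.sum_range_succ] at hch
        have hlead : A.charpoly.coeff n = 1 := by
          have := (Matrix.charpoly_monic A).coeff_natDegree
          rwa [hd] at this
        rw [hlead, one_smul] at hch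
        have hA : A ^ n = -∑ i ∈ Finset.range n, A.charpoly.coeff i • A ^ i :=
          eq_neg_of_add_eq_zero_right hch
        have : (A ^ n * B).col j =
            -∑ i ∈ Finset.range n, A.charpoly.coeff i • (A ^ i * B).col j := by
          rw [hA]
          ext x
          simp only [Matrix.neg_mul, Matrix.sum_mul, Matrix.smul_mul, Pi.neg_apply,
            Finset.sum_apply, Pi.smul_apply, Matrix.col_apply, Matrix.neg_apply,
            Matrix.sum_apply, Matrix.smul_apply]
        rw [this]
        exact Submodule.neg_mem _ (Submodule.sum_mem _ fun i hi =>
          Submodule.smul_mem _ _ (hcol i j (Finset.mem_range.mp hi)))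
    · rw [Submodule.span_le]
      rintro _ ⟨⟨t, j⟩, rfl⟩
      exact Submodule.subset_span ⟨(t.castSucc, j), rfl⟩
  rw [h]

/-- For `n ≥ 1` the minimum that defines the structural controllability index exists. -/
theorem structuralControllabilityIndex_isLeast {n m : ℕ} (hn : 1 ≤ n) (A : StructuredMatrix n n)
    (B : StructuredMatrix n m) :
    IsLeast (stallingSteps A B) (structuralControllabilityIndex A B) := by
  have hne : (stallingSteps A B).Nonempty := by
    refine ⟨n, hn, le_rfl, ?_⟩
    unfold ctrbGenericRank ctrbRanks
    simp only [ctrbMatrix_rank_stalls]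
  exact ⟨Nat.sInf_mem hne, fun k hk => Nat.sInf_le hk⟩

/-- Essentially covered state nodes are nodes of the cactus structure. -/
theorem IsCactusStructure.subset_toLeft {n m : ℕ} {A : StructuredMatrix n n}
    {B : StructuredMatrix n m} {N : Finset (SysNode n m)}
    {E : Finset (SysNode n m × SysNode n m)} {S : Finset (Fin n)}
    (h : IsCactusStructure A B N E S) : S ⊆ N.toLeft := by
  induction h with
  | stem p hp => exact Finset.Subset.refl _
  | attach N E S former c hc hcN p hp hstart hend hpE ih =>
    intro x hx
    simp only [Finset.mem_union, Finset.mem_toLeft] at hx ⊢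
    rcases hx with hx | hx
    · exact Or.inl (Or.inl (Finset.mem_toLeft.mp (ih hx)))
    · exact Or.inr hx

/-- The set of attained values is bounded by `n`, so the supremum in `maxEssCount` is a maximum. -/
theorem maxEssCount_isGreatest {n m : ℕ} (A : StructuredMatrix n n) (B : StructuredMatrix n m) :
    IsGreatest (Set.range (CactusStructureFamily.essCount (A := A) (B := B)))
      (maxEssCount A B) := by
  have hne : (Set.range (CactusStructureFamily.essCount (A := A) (B := B))).Nonempty :=
    ⟨_, ⟨0, Fin.elim0, fun i => i.elim0⟩, rfl⟩
  have hb : BddAbove (Set.range (CactusStructureFamily.essCount (A := A) (B := B))) := by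
    refine ⟨n, ?_⟩
    rintro _ ⟨F, rfl⟩
    unfold CactusStructureFamily.essCount
    rw [← Finset.card_biUnion]
    · simpa using Finset.card_le_univ (Finset.univ.biUnion fun i => (F.member i).essCovered)
    · intro i _ j _ hij
      rw [Function.onFun, Finset.disjoint_left]
      intro x hi hj
      exact Finset.disjoint_left.mp (F.disjoint i j hij)
        (Finset.mem_toLeft.mp ((F.member i).isCactusStructure.subset_toLeft hi))
        (Finset.mem_toLeft.mp ((F.member j).isCactusStructure.subset_toLeft hj))
  exact ⟨Nat.sSup_mem hne hb, fun r hr => le_csSup hb hr⟩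

/-!
Write `es` for the maximum number of essentially covered states. The theorem follows from two bounds
on the generic ranks of the controllability matrices.

*Upper bound* (`rank_ctrbMatrix_le_maxEssCount`): no realization has a controllability matrix of
rank above `es`. Let `V` be the controllable subspace; the edges that leave states which cannot be
reached from the inputs may be deleted without changing it. Since `V = A V + im B`, there is a
feedback `F` for which `A + B F` is injective on `V`, so `X` divides the characteristic polynomial
of `A + B F` at most `n - dim V` times. This polynomial is the determinant of
`[[X - A, B], [F, 1]]`, hence some Leibniz term of that determinant has at most `n - dim V` factors
equal to `X`. The permutation of this term enters each of the other states, at least `dim V` many,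
through an edge of the digraph: they are covered by disjoint stems (its segments between inputs) and
cycles (its orbits without inputs), all reachable from the inputs. Shortest paths attach the cycles
to the stems, one at a time, so that a cactus structure family results.

*Lower bound* (`sum_min_le_ctrbGenericRank`): a family whose members essentially cover `d₁, d₂, ...`
states yields a realization whose `k`-step controllability matrix has rank at least
`∑ min dᵢ k`. The members are disjoint, so their weights do not interfere and one cactus structure
can be treated at a time. The entries of the vectors `Aᵗ b` form one power series per state, and the
number of linearly independent series is the dimension of the Krylov space; it suffices to make the
series of the essentially covered states independent. Along a stem they are distinct powers of `X`.
A cycle of length `l` with a weight `c` on one edge contributes `Xʲ y / (1 - c Xˡ)`, `j < l`, and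
for all but finitely many `c` no nontrivial combination of these lies in the span of the earlier
series (`exists_pole_avoiding`). Finally, a Krylov sequence that spans `d` dimensions does so with
its first `d` vectors.

If each member of a maximum family covers at most `k` states, then the generic ranks at the steps
`k` and `k + 1` are both `es`. With one input, the rank at step `k` is at most the number `k` of
columns and at least `min es k`, so it does not stall before step `es`.
-/

/-! ### Feedback and the order of the characteristic polynomial -/

/-- If `f` and `g` together map onto a finite-dimensional space, then `f` can be made injective by
adding a feedback through `g`: the feedback sends the kernel of `f` onto a complement of its
range. -/
theorem exists_feedback_injective {K V U : Type*} [Field K] [AddCommGroup V] [Module K V]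
    [FiniteDimensional K V] [AddCommGroup U] [Module K U] (f : V →ₗ[K] V) (g : U →ₗ[K] V)
    (hfg : LinearMap.range f ⊔ LinearMap.range g = ⊤) :
    ∃ h : V →ₗ[K] U, Function.Injective (f + g ∘ₗ h) := by
  let q := (LinearMap.range f).mkQ
  have hq : Function.Surjective (q ∘ₗ g) := by
    rw [← LinearMap.range_eq_top, LinearMap.range_comp, eq_top_iff]
    intro y _
    obtain ⟨x, rfl⟩ := (LinearMap.range f).mkQ_surjective y
    have hx : x ∈ LinearMap.range f ⊔ LinearMap.range g := hfg ▸ Submodule.mem_top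
    obtain ⟨a, ha, b, hb, rfl⟩ := Submodule.mem_sup.mp hx
    refine ⟨b, hb, ?_⟩
    have : q a = 0 := (Submodule.Quotient.mk_eq_zero _).mpr ha
    rw [map_add]
    rw [show (LinearMap.range f).mkQ a = 0 from this, zero_add]
  obtain ⟨s, hs⟩ := (q ∘ₗ g).exists_rightInverse_of_surjective (LinearMap.range_eq_top.mpr hq)
  obtain ⟨π, hπ⟩ := (LinearMap.ker f).subtype.exists_leftInverse_of_injective
    (Submodule.ker_subtype _)
  have hdim : Module.finrank K (LinearMap.ker f) =
      Module.finrank K (V ⧸ LinearMap.range f) := by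
    have h1 := f.finrank_range_add_finrank_ker
    have h2 := (LinearMap.range f).finrank_quotient_add_finrank
    omega
  let e := LinearEquiv.ofFinrankEq _ _ hdim
  refine ⟨s ∘ₗ e.toLinearMap ∘ₗ π, ?_⟩
  rw [← LinearMap.ker_eq_bot, LinearMap.ker_eq_bot']
  intro x hx
  have hx' : f x + g (s (e (π x))) = 0 := hx
  have h1 : q (f x) = 0 := (Submodule.Quotient.mk_eq_zero _).mpr ⟨x, rfl⟩
  have h2 : q (g (s (e (π x)))) = e (π x) := LinearMap.congr_fun hs (e (π x))
  have h3 : e (π x) = 0 := by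
    have := congrArg q hx'
    rwa [map_add, h1, h2, zero_add, map_zero] at this
  have h4 : π x = 0 := by simpa using h3
  have h5 : x ∈ LinearMap.ker f := by
    rw [LinearMap.mem_ker]
    simpa [h4] using hx'
  have h6 : π x = ⟨x, h5⟩ := LinearMap.congr_fun hπ ⟨x, h5⟩
  rw [h4] at h6
  exact (congrArg Subtype.val h6).symm

/-- The version of `exists_feedback_injective` for a subspace `V` with `V = f V + range g`. -/
theorem exists_feedback_injOn {K E U : Type*} [Field K] [AddCommGroup E] [Module K E]
    [FiniteDimensional K E] [AddCommGroup U] [Module K U] (f : E →ₗ[K] E) (g : U →ₗ[K] E)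
    (V : Submodule K E) (hV : V.map f ⊔ LinearMap.range g = V) :
    ∃ h : E →ₗ[K] U, (∀ x ∈ V, (f + g ∘ₗ h) x ∈ V) ∧ ∀ x ∈ V, (f + g ∘ₗ h) x = 0 → x = 0 := by
  have hf : ∀ x ∈ V, f x ∈ V := fun x hx =>
    (le_sup_left.trans hV.le) (Submodule.mem_map_of_mem hx)
  have hg : ∀ u, g u ∈ V := fun u => (le_sup_right.trans hV.le) ⟨u, rfl⟩
  obtain ⟨h₀, hh₀⟩ := exists_feedback_injective (f.restrict hf) (g.codRestrict V hg) (by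
    rw [eq_top_iff]
    rintro ⟨x, hx⟩ _
    have hx' := hx
    rw [← hV] at hx'
    obtain ⟨_, ⟨a, ha, rfl⟩, _, ⟨u, rfl⟩, hab⟩ := Submodule.mem_sup.mp hx'
    exact Submodule.mem_sup.mpr ⟨_, ⟨⟨a, ha⟩, rfl⟩, _, ⟨u, rfl⟩, Subtype.ext hab⟩)
  obtain ⟨h, hh⟩ := h₀.exists_extend
  have key : ∀ x (hx : x ∈ V), h x = h₀ ⟨x, hx⟩ := fun x hx => LinearMap.congr_fun hh ⟨x, hx⟩
  refine ⟨h, fun x hx => V.add_mem (hf x hx) (hg _), fun x hx h0 => ?_⟩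
  have : (f.restrict hf + g.codRestrict V hg ∘ₗ h₀) ⟨x, hx⟩ = 0 := by
    apply Subtype.ext
    simpa [key x hx] using h0
  have := hh₀ (this.trans (map_zero _).symm)
  simpa using congrArg Subtype.val this

/-- An invariant subspace on which `φ` is injective meets the generalized kernel of `φ` trivially,
and the dimension of the latter is the order at `0` of the characteristic polynomial. -/
theorem finrank_add_natTrailingDegree_charpoly_le {K E : Type*} [Field K] [AddCommGroup E]
    [Module K E] [FiniteDimensional K E] (φ : Module.End K E) (V : Submodule K E)
    (hV : ∀ x ∈ V, φ x ∈ V) (hinj : ∀ x ∈ V, φ x = 0 → x = 0) :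
    Module.finrank K V + φ.charpoly.natTrailingDegree ≤ Module.finrank K E := by
  rw [← φ.finrank_maxGenEigenspace_zero_eq]
  apply Submodule.finrank_add_finrank_le_of_disjoint
  rw [Submodule.disjoint_def]
  intro x hx hx0
  obtain ⟨k, hk⟩ := (Module.End.mem_maxGenEigenspace _ _ _).mp hx0
  rw [zero_smul, sub_zero] at hk
  induction k generalizing x with
  | zero => simpa using hk
  | succ k ih =>
    rw [pow_succ, Module.End.mul_apply] at hk
    refine hinj x hx (ih _ (hV x hx) ?_ hk)
    rw [Module.End.mem_maxGenEigenspace]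
    exact ⟨k, by simpa using hk⟩

/-- The span of the columns of all the matrices `A ^ t * B`: the controllable subspace. -/
def controllableSubspace {ι κ : Type*} [Fintype ι] [DecidableEq ι] (A : Matrix ι ι ℝ)
    (B : Matrix ι κ ℝ) : Submodule ℝ (ι → ℝ) :=
  Submodule.span ℝ (Set.range fun p : ℕ × κ => (A ^ p.1 * B).col p.2)

theorem map_controllableSubspace_sup_range {ι κ : Type*} [Fintype ι] [DecidableEq ι] [Fintype κ]
    [DecidableEq κ] (A : Matrix ι ι ℝ) (B : Matrix ι κ ℝ) :
    (controllableSubspace A B).map A.toLin' ⊔ LinearMap.range B.toLin' =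
      controllableSubspace A B := by
  have hcol : ∀ t j, A.toLin' ((A ^ t * B).col j) = (A ^ (t + 1) * B).col j := by
    intro t j
    rw [pow_succ', Matrix.mul_assoc]
    rfl
  have hrange : LinearMap.range B.toLin' = Submodule.span ℝ (Set.range B.col) :=
    Matrix.range_toLin' B
  apply le_antisymm
  · refine sup_le ?_ ?_
    · unfold controllableSubspace
      rw [Submodule.map_span, Submodule.span_le]
      rintro _ ⟨_, ⟨⟨t, j⟩, rfl⟩, rfl⟩
      rw [SetLike.mem_coe, hcol]
      exact Submodule.subset_span ⟨(t + 1, j), rfl⟩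
    · rw [hrange, Submodule.span_le]
      rintro _ ⟨j, rfl⟩
      exact Submodule.subset_span ⟨(0, j), by simp⟩
  · conv_lhs => unfold controllableSubspace
    rw [Submodule.span_le]
    rintro _ ⟨⟨t, j⟩, rfl⟩
    rcases t with _ | t
    · refine (le_sup_right : LinearMap.range B.toLin' ≤ _) ?_
      rw [hrange]
      exact Submodule.subset_span ⟨j, by simp⟩
    · refine (le_sup_left : (controllableSubspace A B).map A.toLin' ≤ _) ?_
      exact ⟨(A ^ t * B).col j, Submodule.subset_span ⟨(t, j), rfl⟩, hcol t j⟩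

/-- A nonzero Leibniz term of low order in `X`. The characteristic polynomial of the closed loop
`A + B * F` is the determinant of `[[X - A, B], [F, 1]]`. A feedback that is injective on the
controllable subspace makes the order of this determinant at `0` at most the codimension of that
subspace, so one of its Leibniz terms has at most that many diagonal entries `X - 0`. -/
theorem exists_perm_of_controllableSubspace {ι κ : Type*} [Fintype ι] [DecidableEq ι] [Fintype κ]
    [DecidableEq κ] (A : Matrix ι ι ℝ) (B : Matrix ι κ ℝ) :
    ∃ σ : Equiv.Perm (ι ⊕ κ),
      Module.finrank ℝ (controllableSubspace A B) +
        (Finset.univ.filter fun i => σ (Sum.inl i) = Sum.inl i ∧ A i i = 0).card ≤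
          Fintype.card ι ∧
      (∀ i j, σ (Sum.inl i) = Sum.inl j → ¬ (i = j ∧ A i i = 0) → A j i ≠ 0) ∧
      ∀ u j, σ (Sum.inr u) = Sum.inl j → B j u ≠ 0 := by
  obtain ⟨h, hmem, hinj⟩ := exists_feedback_injOn A.toLin' B.toLin' (controllableSubspace A B)
    (map_controllableSubspace_sup_range A B)
  let F : Matrix κ ι ℝ := LinearMap.toMatrix' h
  have hM : A.toLin' + B.toLin' ∘ₗ h = (A + B * F).toLin' := by
    rw [map_add, Matrix.toLin'_mul, Matrix.toLin'_toMatrix']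
  rw [hM] at hmem hinj
  have hle := finrank_add_natTrailingDegree_charpoly_le _ _ hmem hinj
  rw [Matrix.charpoly_toLin', Module.finrank_fintype_fun_eq_card] at hle
  set r := Module.finrank ℝ (controllableSubspace A B)
  let N : Matrix (ι ⊕ κ) (ι ⊕ κ) (Polynomial ℝ) :=
    Matrix.fromBlocks (A.charmatrix) (B.map Polynomial.C) (F.map Polynomial.C) 1
  have hN : N.det = (A + B * F).charpoly := by
    rw [Matrix.det_fromBlocks_one₂₂, Matrix.charpoly]
    congr 1
    unfold Matrix.charmatrix
    simp only [RingHom.mapMatrix_apply, Matrix.map_add Polynomial.C (map_add Polynomial.C),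
      Matrix.map_mul]
    abel
  have hdvd : ¬ (Polynomial.X ^ (Fintype.card ι - r + 1) ∣ N.det) := by
    rw [hN]
    intro hd
    have h0 : (A + B * F).charpoly ≠ 0 := (Matrix.charpoly_monic _).ne_zero
    rw [Polynomial.X_pow_dvd_iff] at hd
    exact Polynomial.coeff_natTrailingDegree_ne_zero.mpr h0 (hd _ (by omega))
  rw [Matrix.det_apply] at hdvd
  obtain ⟨σ, hσ⟩ : ∃ σ : Equiv.Perm (ι ⊕ κ),
      ¬ (Polynomial.X ^ (Fintype.card ι - r + 1) ∣ ∏ v, N (σ v) v) := by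
    by_contra hcon
    push Not at hcon
    exact hdvd (Finset.dvd_sum fun σ _ => by
      rw [Units.smul_def, zsmul_eq_mul]
      exact (hcon σ).mul_left _)
  have hne : ∀ v, N (σ v) v ≠ 0 := fun v hv =>
    hσ ⟨0, (Finset.prod_eq_zero (f := fun v => N (σ v) v) (Finset.mem_univ v) hv).trans
      (mul_zero _).symm⟩
  refine ⟨σ, ?_, ?_, ?_⟩
  · set T := Finset.univ.filter fun i => σ (Sum.inl i) = Sum.inl i ∧ A i i = 0
    have hX : ∀ i ∈ T, N (σ (Sum.inl i)) (Sum.inl i) = Polynomial.X := by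
      intro i hi
      have hi' := (Finset.mem_filter.mp hi).2
      rw [hi'.1]
      simp [N, Matrix.charmatrix_apply_eq, hi'.2]
    have hpow : Polynomial.X ^ T.card ∣ ∏ v, N (σ v) v := by
      have h1 : (∏ v ∈ T.map Function.Embedding.inl, N (σ v) v) = Polynomial.X ^ T.card := by
        rw [Finset.prod_map, ← Finset.prod_const]
        exact Finset.prod_congr rfl hX
      rw [← h1]
      exact Finset.prod_dvd_prod_of_subset _ _ _ (Finset.subset_univ _)
    by_contra hcon
    exact hσ ((pow_dvd_pow _ (by omega)).trans hpow)
  · intro i j hij hnot h0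
    have := hne (Sum.inl i)
    rw [hij] at this
    rcases eq_or_ne i j with rfl | hij'
    · exact hnot ⟨rfl, h0⟩
    · exact this (by simp [N, Matrix.charmatrix_apply_ne _ _ _ hij'.symm, h0])
  · intro u j huj h0
    have := hne (Sum.inr u)
    rw [huj] at this
    exact this (by simp [N, h0])

/-! ### Reachability, and the permutation behind a rank -/

/-- `v` can be reached from some input node along the edges of the system digraph. -/
def IsInputReachable {n m : ℕ} (A : StructuredMatrix n n) (B : StructuredMatrix n m)
    (v : SysNode n m) : Prop :=
  ∃ u : Fin m, Relation.ReflTransGen (systemDigraph A B).Adj (Sum.inr u) v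

/-- The columns of `A ^ t * B` live on the states that are reachable from the inputs, so deleting
the out-edges of the other states does not change `A ^ t * B`. -/
theorem pow_mul_eq_of_isInputReachable {n m : ℕ} {A : StructuredMatrix n n}
    {B : StructuredMatrix n m} {A' A'' : Matrix (Fin n) (Fin n) ℝ} {B' : Matrix (Fin n) (Fin m) ℝ}
    (hA : A.IsRealization A') (hB : B.IsRealization B')
    (h : ∀ i j, IsInputReachable A B (Sum.inl j) → A'' i j = A' i j) (t : ℕ) :
    A'' ^ t * B' = A' ^ t * B' ∧
      ∀ i u, (A' ^ t * B') i u ≠ 0 → IsInputReachable A B (Sum.inl i) := by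
  induction t with
  | zero =>
    refine ⟨by simp, fun i u hiu => ⟨u, Relation.ReflTransGen.single ?_⟩⟩
    rw [pow_zero, Matrix.one_mul] at hiu
    exact not_not.mp (mt (hB i u) hiu)
  | succ t ih =>
    rw [pow_succ', pow_succ', Matrix.mul_assoc, Matrix.mul_assoc, ih.1]
    constructor
    · ext i u
      rw [Matrix.mul_apply, Matrix.mul_apply]
      refine Finset.sum_congr rfl fun j _ => ?_
      by_cases hj : (A' ^ t * B') j u = 0
      · rw [hj, mul_zero, mul_zero]
      · rw [h i j (ih.2 j u hj)]
    · intro i u hiu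
      rw [Matrix.mul_apply] at hiu
      obtain ⟨j, -, hj⟩ := Finset.exists_ne_zero_of_sum_ne_zero hiu
      obtain ⟨w, hw⟩ := ih.2 j u (right_ne_zero_of_mul hj)
      exact ⟨w, hw.tail (not_not.mp (mt (hA i j) (left_ne_zero_of_mul hj)))⟩

/-- The combinatorial trace of a rank: a permutation `σ` of the nodes which, up to the few states
in `T`, enters every state through an edge of the system digraph and within the part that is
reachable from the inputs. -/
theorem exists_perm_of_rank_ctrbMatrix {n m : ℕ} {A : StructuredMatrix n n}
    {B : StructuredMatrix n m} {A' : Matrix (Fin n) (Fin n) ℝ} {B' : Matrix (Fin n) (Fin m) ℝ}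
    (hA : A.IsRealization A') (hB : B.IsRealization B') (k : ℕ) :
    ∃ (σ : Equiv.Perm (SysNode n m)) (T : Finset (Fin n)),
      (ctrbMatrix k A' B').rank + T.card ≤ n ∧ (∀ i ∈ T, σ (Sum.inl i) = Sum.inl i) ∧
      ∀ v i, σ v = Sum.inl i → i ∉ T →
        (systemDigraph A B).Adj v (Sum.inl i) ∧ IsInputReachable A B (Sum.inl i) := by
  classical
  let A'' : Matrix (Fin n) (Fin n) ℝ :=
    Matrix.of fun i j => if IsInputReachable A B (Sum.inl j) then A' i j else 0
  have hA'' : ∀ i j, A'' i j = if IsInputReachable A B (Sum.inl j) then A' i j else 0 :=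
    fun _ _ => rfl
  have hpow := pow_mul_eq_of_isInputReachable (A'' := A'') hA hB fun i j hj => by
    rw [hA'', if_pos hj]
  obtain ⟨σ, hcard, hstate, hinput⟩ := exists_perm_of_controllableSubspace A'' B'
  rw [Fintype.card_fin] at hcard
  have hrank : (ctrbMatrix k A' B').rank ≤ Module.finrank ℝ (controllableSubspace A'' B') := by
    rw [Matrix.rank_eq_finrank_span_cols]
    apply Submodule.finrank_mono
    rw [Submodule.span_le]
    rintro _ ⟨⟨t, u⟩, rfl⟩
    refine Submodule.subset_span ⟨(t, u), ?_⟩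
    simp only [(hpow t).1]
    rfl
  refine ⟨σ, _, (Nat.add_le_add_right hrank _).trans hcard, fun i hi => ?_, fun v i hvi hi => ?_⟩
  · exact (Finset.mem_filter.mp hi).2.1
  · rcases v with j | u
    · have hne : A'' i j ≠ 0 := by
        refine hstate j i hvi ?_
        rintro ⟨rfl, h0⟩
        exact hi (Finset.mem_filter.mpr ⟨Finset.mem_univ _, hvi, h0⟩)
      rw [hA''] at hne
      split_ifs at hne with hj
      · have hadj : (systemDigraph A B).Adj (Sum.inl j) (Sum.inl i) :=
          not_not.mp (mt (hA i j) hne)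
        obtain ⟨w, hw⟩ := hj
        exact ⟨hadj, w, hw.tail hadj⟩
      · exact absurd rfl hne
    · have hadj : (systemDigraph A B).Adj (Sum.inr u) (Sum.inl i) :=
        not_not.mp (mt (hB i u) (hinput u i hvi))
      exact ⟨hadj, u, Relation.ReflTransGen.single hadj⟩

/-! ### Paths, stems and cycles as sequences of nodes -/

/-- The list `[g 0, ..., g k]`. -/
def walkList {V : Type} (g : ℕ → V) (k : ℕ) : List V :=
  (List.range (k + 1)).map g

theorem mem_walkList {V : Type} {g : ℕ → V} {k : ℕ} {v : V} :
    v ∈ walkList g k ↔ ∃ i ≤ k, g i = v := by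
  simp [walkList]

theorem isPathList_walkList {V : Type} {G : Digraph V} {g : ℕ → V} {k : ℕ} (hk : 1 ≤ k)
    (hadj : ∀ i < k, G.Adj (g i) (g (i + 1))) : G.IsPathList (walkList g k) := by
  refine ⟨by simp [walkList, hk], ?_⟩
  rw [walkList, List.isChain_map, List.isChain_range]
  intro i hi
  exact hadj i (by omega)

theorem nodup_walkList {V : Type} {g : ℕ → V} {k : ℕ} (hg : Set.InjOn g (Set.Iic k)) :
    (walkList g k).Nodup :=
  List.nodup_range.map_on fun _ hi _ hj hij =>
    hg (Nat.lt_succ_iff.mp (List.mem_range.mp hi)) (Nat.lt_succ_iff.mp (List.mem_range.mp hj)) hij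

theorem head?_walkList {V : Type} (g : ℕ → V) (k : ℕ) : (walkList g k).head? = some (g 0) := by
  simp [walkList, List.range_succ_eq_map]

theorem getLast?_walkList {V : Type} (g : ℕ → V) (k : ℕ) :
    (walkList g k).getLast? = some (g k) := by
  simp [walkList, List.range_succ]

theorem tail_walkList {V : Type} (g : ℕ → V) (k : ℕ) :
    (walkList g k).tail = (List.range k).map fun i => g (i + 1) := by
  simp [walkList, List.range_succ_eq_map, Function.comp_def]

theorem mem_of_mem_pathEdges {V : Type} [DecidableEq V] {p : List V} {a b : V}
    (h : (a, b) ∈ pathEdges p) : a ∈ p ∧ b ∈ p.tail :=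
  List.of_mem_zip (List.mem_toFinset.mp h)

theorem IsCactusStructure.mem_nodes_of_mem_edges {n m : ℕ} {A : StructuredMatrix n n}
    {B : StructuredMatrix n m} {N : Finset (SysNode n m)}
    {E : Finset (SysNode n m × SysNode n m)} {S : Finset (Fin n)}
    (h : IsCactusStructure A B N E S) {a b : SysNode n m} (hab : (a, b) ∈ E) : b ∈ N := by
  induction h with
  | stem p hp => exact List.mem_toFinset.mpr (List.mem_of_mem_tail (mem_of_mem_pathEdges hab).2)
  | attach N E S former c hc hcN p hp hstart hend hpE ih =>
    simp only [Finset.mem_union, List.mem_toFinset] at hab ⊢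
    rcases hab with (hab | hab) | hab
    · exact Or.inl (Or.inl (ih hab))
    · exact Or.inl (Or.inr (List.mem_of_mem_tail (mem_of_mem_pathEdges hab).2))
    · exact Or.inr (List.mem_of_mem_tail (mem_of_mem_pathEdges hab).2)

/-- Every edge of the system digraph enters a state node. -/
theorem exists_inl_of_adj {n m : ℕ} {A : StructuredMatrix n n} {B : StructuredMatrix n m}
    {v w : SysNode n m} (h : (systemDigraph A B).Adj v w) : ∃ x, w = Sum.inl x := by
  rcases w with x | u
  · exact ⟨x, rfl⟩
  · rcases v with _ | _ <;> exact h.elim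

theorem exists_cactus_of_stem {n m : ℕ} {A : StructuredMatrix n n} {B : StructuredMatrix n m}
    {g : ℕ → SysNode n m} {k : ℕ} (hk : 1 ≤ k)
    (hadj : ∀ i < k, (systemDigraph A B).Adj (g i) (g (i + 1))) (hg : Set.InjOn g (Set.Iic k))
    (h0 : ∃ u, g 0 = Sum.inr u) :
    ∃ C : CactusStructure A B, C.nodes = (walkList g k).toFinset ∧
      C.essCovered = (walkList g k).toFinset.toLeft := by
  obtain ⟨u, hu⟩ := h0
  have hlast : ∃ x, g k = Sum.inl x := by
    obtain ⟨k, rfl⟩ := Nat.exists_eq_add_of_le' hk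
    exact exists_inl_of_adj (hadj k (Nat.lt_succ_self k))
  obtain ⟨x, hx⟩ := hlast
  exact ⟨⟨_, _, _, .stem (walkList g k) ⟨isPathList_walkList hk hadj, nodup_walkList hg,
    ⟨u, by rw [head?_walkList, hu]⟩, ⟨x, by rw [getLast?_walkList, hx]⟩⟩⟩, rfl, rfl⟩

theorem exists_cactus_attach {n m : ℕ} {A : StructuredMatrix n n} {B : StructuredMatrix n m}
    (C : CactusStructure A B) {g c : ℕ → SysNode n m} {k l : ℕ} (hk : 1 ≤ k) (hl : 1 ≤ l)
    (hadj : ∀ i < k, (systemDigraph A B).Adj (g i) (g (i + 1))) (h0 : g 0 ∈ C.nodes)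
    (hg : ∀ i, 1 ≤ i → i ≤ k → g i ∉ C.nodes)
    (hcadj : ∀ i < l, (systemDigraph A B).Adj (c i) (c (i + 1))) (hcl : c l = c 0)
    (hinj : Set.InjOn c (Set.Iio l)) (hgc : g k = c 0) (hc : ∀ i ≤ l, c i ∉ C.nodes) :
    ∃ D : CactusStructure A B,
      D.nodes = C.nodes ∪ (walkList g k).toFinset ∪ (walkList c l).toFinset ∧
      D.essCovered = C.essCovered ∪ (walkList c l).toFinset.toLeft := by
  have hcycle : (systemDigraph A B).IsCycleList (walkList c l) := by
    refine ⟨isPathList_walkList hl hcadj, ?_, ?_⟩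
    · rw [head?_walkList, getLast?_walkList, hcl]
    · rw [tail_walkList]
      -- The tail lists the values at `1, ..., l`; the value at `l` is the one at `0`.
      have hred : ∀ i < l, ∃ j < l, c (i + 1) = c j ∧ (j = i + 1 ∨ j = 0 ∧ i + 1 = l) := by
        intro i hi
        rcases Nat.lt_or_ge (i + 1) l with h | h
        · exact ⟨i + 1, h, rfl, Or.inl rfl⟩
        · have : i + 1 = l := by omega
          exact ⟨0, hl, by rw [this, hcl], Or.inr ⟨rfl, this⟩⟩
      refine List.nodup_range.map_on fun i hi j hj hij => ?_
      obtain ⟨i', hi', hci, hii⟩ := hred i (List.mem_range.mp hi)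
      obtain ⟨j', hj', hcj, hjj⟩ := hred j (List.mem_range.mp hj)
      have : i' = j' := hinj hi' hj' (by rw [← hci, ← hcj]; exact hij)
      omega
  refine ⟨⟨_, _, _, .attach C.nodes C.edges C.essCovered C.isCactusStructure (walkList c l) hcycle
    ?_ (walkList g k) (isPathList_walkList hk hadj) ⟨g 0, h0, head?_walkList g k⟩
    ⟨g k, ?_, getLast?_walkList g k⟩ ?_⟩, rfl, rfl⟩
  · rw [Finset.disjoint_left]
    intro v hv
    obtain ⟨i, hi, rfl⟩ := mem_walkList.mp (List.mem_toFinset.mp hv)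
    exact hc i hi
  · exact mem_walkList.mpr ⟨0, Nat.zero_le _, hgc.symm⟩
  · rw [Finset.disjoint_left]
    rintro ⟨a, b⟩ hab hE
    have hb := (mem_of_mem_pathEdges hab).2
    rw [tail_walkList] at hb
    obtain ⟨i, hi, rfl⟩ := List.mem_map.mp hb
    have := List.mem_range.mp hi
    exact hg (i + 1) (by omega) (by omega) (C.isCactusStructure.mem_nodes_of_mem_edges hE)

/-- A shortest path from a set `P` to a set `Q`: it leaves `P` at once, meets `Q` only at its end,
and repeats no node. -/
theorem exists_shortest_path {V : Type} {r : V → V → Prop} {P Q : V → Prop} {a b : V}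
    (hab : Relation.ReflTransGen r a b) (ha : P a) (hb : Q b) :
    ∃ (k : ℕ) (g : ℕ → V), P (g 0) ∧ Q (g k) ∧ (∀ i < k, r (g i) (g (i + 1))) ∧
      (∀ i, 1 ≤ i → i ≤ k → ¬ P (g i)) ∧ (∀ i < k, ¬ Q (g i)) ∧ Set.InjOn g (Set.Iic k) := by
  classical
  have hex : ∃ (k : ℕ) (g : ℕ → V), P (g 0) ∧ Q (g k) ∧ ∀ i < k, r (g i) (g (i + 1)) := by
    have : ∃ (k : ℕ) (g : ℕ → V), g 0 = a ∧ g k = b ∧ ∀ i < k, r (g i) (g (i + 1)) := by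
      clear hb
      induction hab with
      | refl => exact ⟨0, fun _ => a, rfl, rfl, by simp⟩
      | @tail b c _ hbc ih =>
        obtain ⟨k, g, h0, hk, hg⟩ := ih
        refine ⟨k + 1, fun i => if i ≤ k then g i else c, by simp [h0], by simp, fun i hi => ?_⟩
        rcases Nat.lt_or_ge i k with h | h
        · simpa [h.le, Nat.succ_le_of_lt h] using hg i h
        · have : i = k := by omega
          subst this
          simpa [hk] using hbc
    obtain ⟨k, g, rfl, rfl, hg⟩ := this
    exact ⟨k, g, ha, hb, hg⟩
  obtain ⟨g, h0, hk, hg⟩ := Nat.find_spec hex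
  have hmin : ∀ k' < Nat.find hex, ∀ g' : ℕ → V, P (g' 0) → Q (g' k') →
      ¬ ∀ i < k', r (g' i) (g' (i + 1)) := fun k' hk' g' h1 h2 h3 =>
    Nat.find_min hex hk' ⟨g', h1, h2, h3⟩
  set k := Nat.find hex
  have hinj : ∀ i j, i < j → j ≤ k → g i ≠ g j := by
    intro i j hij hj heq
    refine hmin (k - (j - i)) (by omega) (fun t => if t ≤ i then g t else g (t + (j - i)))
      (by simpa using h0) ?_ fun t ht => ?_
    · split_ifs with h
      · have h1 : k - (j - i) = i := by omega
        have h2 : j = k := by omega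
        rw [h1, heq, h2]
        exact hk
      · rwa [Nat.sub_add_cancel (by omega)]
    · rcases Nat.lt_trichotomy t i with h | rfl | h
      · rw [if_pos h.le, if_pos (Nat.succ_le_of_lt h)]
        exact hg t (by omega)
      · rw [if_pos le_rfl, if_neg (by omega), heq,
          show t + 1 + (j - t) = j + 1 by omega]
        exact hg j (by omega)
      · rw [if_neg (by omega), if_neg (by omega), show t + 1 + (j - i) = t + (j - i) + 1 by omega]
        exact hg _ (by omega)
  refine ⟨k, g, h0, hk, hg, fun i hi hik hP => ?_, fun i hi hQ => ?_, fun i hi j hj hij => ?_⟩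
  · refine hmin (k - i) (by omega) (fun t => g (t + i)) (by simpa using hP) ?_ fun t ht => ?_
    · simpa [Nat.sub_add_cancel hik] using hk
    · simp only [show t + 1 + i = t + i + 1 by omega]
      exact hg _ (by omega)
  · exact hmin i hi g h0 hQ fun t ht => hg t (by omega)
  · rcases Nat.lt_trichotomy i j with h | h | h
    · exact absurd hij (hinj i j h hj)
    · exact h
    · exact absurd hij.symm (hinj j i h hi)

/-! ### Building cactus structure families -/

/-- Attaching one more cycle to a family. A shortest path reaches the set `R` of nodes that are
still free from the inputs and from the nodes in use. If it starts in a member of the family, that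
member takes the cycle on; if it starts at an unused input, the path and the cycle (without its
last edge) form a new stem. Either way all nodes in use stay outside the rest of `R`. -/
theorem exists_family_attach_cycle {n m : ℕ} {A : StructuredMatrix n n} {B : StructuredMatrix n m}
    (σ : Equiv.Perm (SysNode n m)) (R : Finset (SysNode n m)) (hσ : ∀ v ∈ R, σ v ∈ R)
    (hadj : ∀ v ∈ R, (systemDigraph A B).Adj v (σ v)) (hstate : ∀ v ∈ R, ∃ x, v = Sum.inl x)
    (hreach : ∀ v ∈ R, IsInputReachable A B v) (hR : R.Nonempty)
    (ι : Type) [Fintype ι] (C : ι → CactusStructure A B)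
    (hC : Pairwise fun i j => Disjoint (C i).nodes (C j).nodes)
    (hCR : ∀ i, Disjoint (C i).nodes R) :
    ∃ cyc ⊆ R, cyc.Nonempty ∧ (∀ v ∈ R \ cyc, σ v ∈ R \ cyc) ∧
      ∃ (ι' : Type) (_ : Fintype ι') (C' : ι' → CactusStructure A B),
        (Pairwise fun i j => Disjoint (C' i).nodes (C' j).nodes) ∧
        (∀ i, Disjoint (C' i).nodes (R \ cyc)) ∧
        (∀ i, ∀ x ∈ (C i).essCovered, ∃ j, x ∈ (C' j).essCovered) ∧
        ∀ x, Sum.inl x ∈ cyc → ∃ j, x ∈ (C' j).essCovered := by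
  classical
  obtain ⟨v₀, hv₀⟩ := hR
  obtain ⟨u₀, hu₀⟩ := hreach v₀ hv₀
  obtain ⟨k, g, hP, hQ, hg, hnP, hnQ, hginj⟩ := exists_shortest_path
    (P := fun v => (∃ u, v = Sum.inr u) ∨ ∃ i, v ∈ (C i).nodes) (Q := fun v => v ∈ R) hu₀
    (Or.inl ⟨u₀, rfl⟩) hv₀
  have hPR : ∀ v ∈ R, ¬ ((∃ u, v = Sum.inr u) ∨ ∃ i, v ∈ (C i).nodes) := by
    rintro v hv (⟨u, rfl⟩ | ⟨i, hi⟩)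
    · obtain ⟨x, hx⟩ := hstate _ hv
      cases hx
    · exact Finset.disjoint_left.mp (hCR i) hi hv
  have hk : 1 ≤ k := by
    rcases Nat.eq_zero_or_pos k with rfl | h
    · exact absurd hP (hPR _ hQ)
    · exact h
  set w := g k
  set l := Function.minimalPeriod σ w
  have hlpos : 1 ≤ l :=
    Function.minimalPeriod_pos_of_mem_periodicPts (σ.injective.mem_periodicPts w)
  let c : ℕ → SysNode n m := fun i => σ^[i] w
  have hc0 : c 0 = w := rfl
  have hcl : c l = c 0 := Function.iterate_minimalPeriod
  have hcs : ∀ i, c (i + 1) = σ (c i) := fun i => Function.iterate_succ_apply' σ i w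
  have hcinj : Set.InjOn c (Set.Iio l) := Function.iterate_injOn_Iio_minimalPeriod
  have hcR : ∀ i, c i ∈ R := by
    intro i
    induction i with
    | zero => exact hQ
    | succ i ih => rw [hcs]; exact hσ _ ih
  have hcC : ∀ i j, c i ∉ (C j).nodes := fun i j h => hPR _ (hcR i) (Or.inr ⟨j, h⟩)
  have hcadj : ∀ i, (systemDigraph A B).Adj (c i) (c (i + 1)) := fun i => by
    rw [hcs]; exact hadj _ (hcR i)
  set cyc := (walkList c l).toFinset with hcyc
  have hmem : ∀ v, v ∈ cyc ↔ ∃ i ≤ l, c i = v := fun v => by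
    rw [hcyc, List.mem_toFinset, mem_walkList]
  have hcycR : cyc ⊆ R := fun v hv => by
    obtain ⟨i, -, rfl⟩ := (hmem v).mp hv
    exact hcR i
  have hgC : ∀ i, 1 ≤ i → i ≤ k → ∀ j, g i ∉ (C j).nodes := fun i hi hik j h =>
    hnP i hi hik (Or.inr ⟨j, h⟩)
  have hgR : ∀ i ≤ k, g i ∉ R \ cyc := by
    intro i hi h
    rcases Nat.lt_or_ge i k with h' | h'
    · exact hnQ i h' (Finset.mem_sdiff.mp h).1
    · have : i = k := by omega
      subst this
      exact (Finset.mem_sdiff.mp h).2 ((hmem _).mpr ⟨0, Nat.zero_le _, rfl⟩)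
  refine ⟨cyc, hcycR, ⟨w, (hmem w).mpr ⟨0, Nat.zero_le _, rfl⟩⟩, ?_, ?_⟩
  · intro v hv
    obtain ⟨hvR, hvc⟩ := Finset.mem_sdiff.mp hv
    refine Finset.mem_sdiff.mpr ⟨hσ v hvR, fun h => hvc ?_⟩
    obtain ⟨i, hi, hiv⟩ := (hmem _).mp h
    have : ∃ i < l, c (i + 1) = σ v := by
      rcases i with _ | i
      · exact ⟨l - 1, by omega, by rw [Nat.sub_add_cancel hlpos, hcl, hiv]⟩
      · exact ⟨i, by omega, hiv⟩
    obtain ⟨i, hi, hiv⟩ := this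
    rw [hcs] at hiv
    exact (hmem _).mpr ⟨i, hi.le, σ.injective hiv⟩
  by_cases hin : ∃ i₀, g 0 ∈ (C i₀).nodes
  · obtain ⟨i₀, hi₀⟩ := hin
    obtain ⟨D, hDn, hDe⟩ := exists_cactus_attach (C i₀) hk hlpos hg hi₀
      (fun i hi hik => hgC i hi hik i₀) (fun i _ => hcadj i) hcl hcinj rfl (fun i _ => hcC i i₀)
    have hDmem : ∀ v ∈ D.nodes, v ∈ (C i₀).nodes ∨ (∃ i, 1 ≤ i ∧ i ≤ k ∧ g i = v) ∨ v ∈ cyc := by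
      intro v hv
      rw [hDn, Finset.mem_union, Finset.mem_union, List.mem_toFinset, mem_walkList] at hv
      rcases hv with (hv | ⟨i, hi, rfl⟩) | hv
      · exact Or.inl hv
      · rcases i with _ | i
        · exact Or.inl hi₀
        · exact Or.inr (Or.inl ⟨i + 1, by omega, hi, rfl⟩)
      · exact Or.inr (Or.inr hv)
    have hDC : ∀ j, j ≠ i₀ → Disjoint D.nodes (C j).nodes := by
      intro j hj
      rw [Finset.disjoint_left]
      intro v hv hvj
      rcases hDmem v hv with h | ⟨i, hi, hik, rfl⟩ | h
      · exact Finset.disjoint_left.mp (hC hj) hvj h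
      · exact hgC i hi hik j hvj
      · exact Finset.disjoint_left.mp (hCR j) hvj (hcycR h)
    refine ⟨ι, inferInstance, Function.update C i₀ D, ?_, ?_, ?_, ?_⟩
    · intro i j hij
      rcases eq_or_ne i i₀ with rfl | hi
      · rw [Function.update_self, Function.update_of_ne hij.symm]
        exact hDC j hij.symm
      · rcases eq_or_ne j i₀ with rfl | hj
        · rw [Function.update_self, Function.update_of_ne hij]
          exact (hDC i hij).symm
        · rw [Function.update_of_ne hi, Function.update_of_ne hj]
          exact hC hij
    · intro i
      rcases eq_or_ne i i₀ with rfl | hi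
      · rw [Function.update_self, Finset.disjoint_left]
        intro v hv hvR
        rcases hDmem v hv with h | ⟨i, -, hik, rfl⟩ | h
        · exact Finset.disjoint_left.mp (hCR _) h (Finset.mem_sdiff.mp hvR).1
        · exact hgR i hik hvR
        · exact (Finset.mem_sdiff.mp hvR).2 h
      · rw [Function.update_of_ne hi]
        exact (hCR i).mono_right Finset.sdiff_subset
    · intro i x hx
      refine ⟨i, ?_⟩
      rcases eq_or_ne i i₀ with rfl | hi
      · rw [Function.update_self, hDe]
        exact Finset.mem_union_left _ hx
      · rwa [Function.update_of_ne hi]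
    · intro x hx
      refine ⟨i₀, ?_⟩
      rw [Function.update_self, hDe]
      exact Finset.mem_union_right _ (Finset.mem_toLeft.mpr hx)
  · have hu : ∃ u, g 0 = Sum.inr u := hP.resolve_right hin
    have hgC' : ∀ i ≤ k, ∀ j, g i ∉ (C j).nodes := by
      intro i hik j hj
      rcases i with _ | i
      · exact hin ⟨j, hj⟩
      · exact hgC _ (by omega) hik j hj
    let h : ℕ → SysNode n m := fun i => if i ≤ k then g i else c (i - k)
    have hle : ∀ i ≤ k, h i = g i := fun i hi => if_pos hi
    have hge : ∀ i, k ≤ i → h i = c (i - k) := by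
      intro i hi
      rcases hi.eq_or_lt with rfl | hi
      · rw [hle _ le_rfl, Nat.sub_self, hc0]
      · exact if_neg (by omega)
    obtain ⟨D, hDn, hDe⟩ := exists_cactus_of_stem (A := A) (B := B) (g := h) (k := k + (l - 1))
      (by omega)
      (fun i hi => by
        rcases Nat.lt_or_ge i k with hik | hik
        · rw [hle i hik.le, hle (i + 1) hik]
          exact hg i hik
        · rw [hge i hik, hge (i + 1) (by omega), Nat.sub_add_comm hik]
          exact hcadj _)
      (fun i hi j hj hij => by
        have hi' : i ≤ k + (l - 1) := hi
        have hj' : j ≤ k + (l - 1) := hj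
        rcases Nat.lt_or_ge i k with hik | hik <;> rcases Nat.lt_or_ge j k with hjk | hjk
        · rw [hle i hik.le, hle j hjk.le] at hij
          exact hginj hik.le hjk.le hij
        · rw [hle i hik.le, hge j hjk] at hij
          exact absurd (hij ▸ hcR _) (hnQ i hik)
        · rw [hge i hik, hle j hjk.le] at hij
          exact absurd (hij ▸ hcR _) (hnQ j hjk)
        · rw [hge i hik, hge j hjk] at hij
          have : i - k = j - k :=
            hcinj (Set.mem_Iio.mpr (by omega)) (Set.mem_Iio.mpr (by omega)) hij
          omega)
      ⟨hu.choose, (hle 0 (Nat.zero_le _)).trans hu.choose_spec⟩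
    have hDmem : ∀ v ∈ D.nodes, (∃ i ≤ k, g i = v) ∨ v ∈ cyc := by
      intro v hv
      rw [hDn, List.mem_toFinset, mem_walkList] at hv
      obtain ⟨i, hi, rfl⟩ := hv
      rcases Nat.lt_or_ge i k with hik | hik
      · exact Or.inl ⟨i, hik.le, (hle i hik.le).symm⟩
      · exact Or.inr ((hmem _).mpr ⟨i - k, by omega, (hge i hik).symm⟩)
    have hDC : ∀ j, Disjoint D.nodes (C j).nodes := by
      intro j
      rw [Finset.disjoint_left]
      intro v hv hvj
      rcases hDmem v hv with ⟨i, hik, rfl⟩ | h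
      · exact hgC' i hik j hvj
      · exact Finset.disjoint_left.mp (hCR j) hvj (hcycR h)
    refine ⟨Option ι, inferInstance, fun o => o.elim D C, ?_, ?_, ?_, ?_⟩
    · rintro (_ | i) (_ | j) hij
      · exact absurd rfl hij
      · exact hDC j
      · exact (hDC i).symm
      · exact hC fun h => hij (congrArg some h)
    · rintro (_ | i)
      · refine Finset.disjoint_left.mpr fun v hv hvR => ?_
        rcases hDmem v hv with ⟨i, hik, rfl⟩ | h
        · exact hgR i hik hvR
        · exact (Finset.mem_sdiff.mp hvR).2 h
      · exact (hCR i).mono_right Finset.sdiff_subset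
    · exact fun i x hx => ⟨some i, hx⟩
    · intro x hx
      refine ⟨none, ?_⟩
      change x ∈ D.essCovered
      rw [hDe, Finset.mem_toLeft, List.mem_toFinset, mem_walkList]
      obtain ⟨i, hi, hix⟩ := (hmem _).mp hx
      -- The last node of the closed walk around the cycle is also its first one.
      have : ∃ i < l, c i = Sum.inl x := by
        rcases hi.eq_or_lt with rfl | hi
        · exact ⟨0, hlpos, by rw [← hcl, hix]⟩
        · exact ⟨i, hi, hix⟩
      obtain ⟨i, hi, hix⟩ := this
      exact ⟨k + i, by omega, by rw [hge _ (by omega), Nat.add_sub_cancel_left, hix]⟩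

theorem exists_family_attach_cycles {n m : ℕ} {A : StructuredMatrix n n}
    {B : StructuredMatrix n m} (σ : Equiv.Perm (SysNode n m)) (R : Finset (SysNode n m))
    (hσ : ∀ v ∈ R, σ v ∈ R) (hadj : ∀ v ∈ R, (systemDigraph A B).Adj v (σ v))
    (hstate : ∀ v ∈ R, ∃ x, v = Sum.inl x) (hreach : ∀ v ∈ R, IsInputReachable A B v)
    (ι : Type) [Fintype ι] (C : ι → CactusStructure A B)
    (hC : Pairwise fun i j => Disjoint (C i).nodes (C j).nodes)
    (hCR : ∀ i, Disjoint (C i).nodes R) :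
    ∃ (ι' : Type) (_ : Fintype ι') (C' : ι' → CactusStructure A B),
      (Pairwise fun i j => Disjoint (C' i).nodes (C' j).nodes) ∧
      (∀ i, ∀ x ∈ (C i).essCovered, ∃ j, x ∈ (C' j).essCovered) ∧
      ∀ x, Sum.inl x ∈ R → ∃ j, x ∈ (C' j).essCovered := by
  induction R using Finset.strongInduction generalizing ι with
  | H R ih =>
    rcases R.eq_empty_or_nonempty with rfl | hR
    · exact ⟨ι, inferInstance, C, hC, fun i x hx => ⟨i, hx⟩, by simp⟩
    · obtain ⟨cyc, hcyc, hne, hclosed, ι₁, _, C₁, hC₁, hCR₁, hold, hnew⟩ :=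
        exists_family_attach_cycle σ R hσ hadj hstate hreach hR ι C hC hCR
      have hsub : R \ cyc ⊆ R := Finset.sdiff_subset
      obtain ⟨ι₂, hι₂, C₂, hC₂, hold₂, hnew₂⟩ := ih (R \ cyc)
        (Finset.sdiff_ssubset hcyc hne) hclosed (fun v hv => hadj v (hsub hv))
        (fun v hv => hstate v (hsub hv)) (fun v hv => hreach v (hsub hv)) ι₁ C₁ hC₁ hCR₁
      refine ⟨ι₂, hι₂, C₂, hC₂, fun i x hx => ?_, fun x hx => ?_⟩
      · obtain ⟨j, hj⟩ := hold i x hx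
        exact hold₂ j x hj
      · by_cases hxc : Sum.inl x ∈ cyc
        · obtain ⟨j, hj⟩ := hnew x hxc
          exact hold₂ j x hj
        · exact hnew₂ x (Finset.mem_sdiff.mpr ⟨hx, hxc⟩)

/-- A permutation of the nodes whose steps into the states outside `T` are edges of the reachable
part of the digraph gives a family that covers all these states: its segments between consecutive
inputs are stems, and its cycles without inputs are attached one by one. -/
theorem exists_family_of_perm {n m : ℕ} {A : StructuredMatrix n n} {B : StructuredMatrix n m}
    (σ : Equiv.Perm (SysNode n m)) (T : Finset (Fin n))
    (hT : ∀ i ∈ T, σ (Sum.inl i) = Sum.inl i)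
    (hσ : ∀ v i, σ v = Sum.inl i → i ∉ T →
      (systemDigraph A B).Adj v (Sum.inl i) ∧ IsInputReachable A B (Sum.inl i)) :
    ∃ (ι : Type) (_ : Fintype ι) (C : ι → CactusStructure A B),
      (Pairwise fun i j => Disjoint (C i).nodes (C j).nodes) ∧
      ∀ x, x ∉ T → ∃ j, x ∈ (C j).essCovered := by
  classical
  have hper : ∀ v, ∃ p, 1 ≤ p ∧ σ^[p] v = v := fun v =>
    ⟨_, Function.minimalPeriod_pos_of_mem_periodicPts (σ.injective.mem_periodicPts v),
      Function.iterate_minimalPeriod⟩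
  -- The first return of the orbit of an input to the set of inputs.
  have hret : ∀ u : Fin m, ∃ k, 1 ≤ k ∧ (∃ u', σ^[k] (Sum.inr u) = Sum.inr u') ∧
      ∀ j, 1 ≤ j → j < k → ∀ u', σ^[j] (Sum.inr u) ≠ Sum.inr u' := by
    intro u
    have hex : ∃ k, 1 ≤ k ∧ ∃ u', σ^[k] (Sum.inr u) = Sum.inr u' := by
      obtain ⟨p, hp, hpu⟩ := hper (Sum.inr u)
      exact ⟨p, hp, u, hpu⟩
    refine ⟨Nat.find hex, (Nat.find_spec hex).1, (Nat.find_spec hex).2, fun j hj hjk u' h => ?_⟩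
    exact Nat.find_min hex hjk ⟨hj, u', h⟩
  choose κ hκ1 hκ hκmin using hret
  have hmeet : ∀ u u' i j, i < κ u → j < κ u' → σ^[i] (Sum.inr u) = σ^[j] (Sum.inr u') →
      i = j ∧ u = u' := by
    have haux : ∀ u u' i j, i ≤ j → j < κ u' → σ^[i] (Sum.inr u) = σ^[j] (Sum.inr u') →
        i = j ∧ u = u' := by
      intro u u' i j hij hj h
      obtain ⟨d, rfl⟩ := Nat.exists_eq_add_of_le hij
      rw [Function.iterate_add_apply] at h
      have h' := (σ.injective.iterate i) h
      rcases Nat.eq_zero_or_pos d with rfl | hd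
      · exact ⟨rfl, by simpa using h'⟩
      · exact absurd h'.symm (hκmin u' d hd (by omega) u)
    intro u u' i j hi hj h
    rcases le_total i j with hij | hij
    · exact haux u u' i j hij hj h
    · obtain ⟨h1, h2⟩ := haux u' u j i hij hi h.symm
      exact ⟨h1.symm, h2.symm⟩
  have hnotT : ∀ u i x, σ^[i] (Sum.inr u) = Sum.inl x → x ∉ T := by
    intro u i x hx hxT
    have h1 : σ (σ^[i] (Sum.inr u)) = σ^[i] (Sum.inr u) := by rw [hx, hT x hxT]
    rw [← Function.iterate_succ_apply' σ, Function.iterate_succ_apply] at h1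
    have h2 : σ (Sum.inr u) = Sum.inr u := (σ.injective.iterate i) h1
    rw [Function.iterate_fixed h2] at hx
    cases hx
  have hstateOf : ∀ u j, 1 ≤ j → j < κ u → ∃ x, σ^[j] (Sum.inr u) = Sum.inl x := by
    intro u j hj hjk
    rcases h : σ^[j] (Sum.inr u) with x | u'
    · exact ⟨x, rfl⟩
    · exact absurd h (hκmin u j hj hjk u')
  have hstem : ∀ s : {u // 2 ≤ κ u}, ∃ C : CactusStructure A B,
      C.nodes = (walkList (fun i => σ^[i] (Sum.inr s.1)) (κ s.1 - 1)).toFinset ∧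
      C.essCovered =
        (walkList (fun i => σ^[i] (Sum.inr s.1)) (κ s.1 - 1)).toFinset.toLeft := by
    rintro ⟨u, hu⟩
    refine exists_cactus_of_stem (by simp only; omega) (fun i hi => ?_) (fun i hi j hj hij => ?_)
      ⟨u, rfl⟩
    · simp only at hi ⊢
      obtain ⟨x, hx⟩ := hstateOf u (i + 1) (by omega) (by omega)
      rw [hx]
      refine (hσ _ x ?_ (hnotT u _ x hx)).1
      rw [← Function.iterate_succ_apply' σ, hx]
    · have hi' : i ≤ κ u - 1 := hi
      have hj' : j ≤ κ u - 1 := hj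
      exact (hmeet u u i j (by omega) (by omega) hij).1
  choose C hCn hCe using hstem
  have hCmem : ∀ s v, v ∈ (C s).nodes ↔ ∃ i < κ s.1, σ^[i] (Sum.inr s.1) = v := by
    intro s v
    rw [hCn, List.mem_toFinset, mem_walkList]
    have := s.2
    constructor
    · rintro ⟨i, hi, rfl⟩
      exact ⟨i, by omega, rfl⟩
    · rintro ⟨i, hi, rfl⟩
      exact ⟨i, by omega, rfl⟩
  let R : Finset (SysNode n m) := Finset.univ.filter fun v =>
    ∃ x, v = Sum.inl x ∧ x ∉ T ∧ ∀ u i, σ^[i] (Sum.inr u) ≠ Sum.inl x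
  have hRσ : ∀ v ∈ R, ∃ y, σ v = Sum.inl y ∧ y ∉ T ∧ ∀ u i, σ^[i] (Sum.inr u) ≠ Sum.inl y := by
    intro v hv
    obtain ⟨x, rfl, hxT, hx⟩ := (Finset.mem_filter.mp hv).2
    rcases h : σ (Sum.inl x) with y | u
    · refine ⟨y, rfl, fun hy => hxT ?_, fun u i hi => ?_⟩
      · have := σ.injective (h.trans (hT y hy).symm)
        rwa [Sum.inl.inj this]
      · rcases i with _ | i
        · cases hi
        · rw [Function.iterate_succ_apply', ← h] at hi
          exact hx u i (σ.injective hi)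
    · obtain ⟨p, hp, hpu⟩ := hper (Sum.inr u)
      obtain ⟨p, rfl⟩ := Nat.exists_eq_add_of_le' hp
      rw [Function.iterate_succ_apply', ← h] at hpu
      exact absurd (h ▸ σ.injective hpu) (hx u p)
  obtain ⟨ι, hι, C', hC', hold, hnew⟩ := exists_family_attach_cycles (A := A) (B := B) σ R
    (fun v hv => by
      obtain ⟨y, hy⟩ := hRσ v hv
      exact Finset.mem_filter.mpr ⟨Finset.mem_univ _, y, hy⟩)
    (fun v hv => by
      obtain ⟨y, hy, hyT, -⟩ := hRσ v hv
      rw [hy]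
      exact (hσ v y hy hyT).1)
    (fun v hv => by
      obtain ⟨x, hx, -⟩ := (Finset.mem_filter.mp hv).2
      exact ⟨x, hx⟩)
    (fun v hv => by
      obtain ⟨x, rfl, hxT, -⟩ := (Finset.mem_filter.mp hv).2
      exact (hσ (σ.symm (Sum.inl x)) x (σ.apply_symm_apply _) hxT).2)
    _ C
    (fun s s' hss => by
      refine Finset.disjoint_left.mpr fun v hv hv' => ?_
      obtain ⟨i, hi, hiv⟩ := (hCmem s v).mp hv
      obtain ⟨j, hj, hjv⟩ := (hCmem s' v).mp hv'
      exact hss (Subtype.ext (hmeet _ _ i j hi hj (hiv.trans hjv.symm)).2))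
    (fun s => by
      rw [Finset.disjoint_left]
      intro v hv hvR
      obtain ⟨i, -, hiv⟩ := (hCmem s v).mp hv
      obtain ⟨x, rfl, -, hx⟩ := (Finset.mem_filter.mp hvR).2
      exact hx _ i hiv)
  refine ⟨ι, hι, C', hC', fun x hxT => ?_⟩
  by_cases hx : ∃ i u, σ^[i] (Sum.inr u) = Sum.inl x
  · -- The last input on the backward orbit of `x` is the root of the stem through `x`.
    obtain ⟨u, hu⟩ := Nat.find_spec hx
    set i := Nat.find hx
    have hi1 : 1 ≤ i := by
      rcases Nat.eq_zero_or_pos i with h | h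
      · rw [h] at hu
        cases hu
      · exact h
    have hik : i < κ u := by
      by_contra hcon
      obtain ⟨u', hu'⟩ := hκ u
      refine Nat.find_min hx (m := i - κ u) (by have := hκ1 u; omega) ⟨u', ?_⟩
      rw [← hu', ← Function.iterate_add_apply, Nat.sub_add_cancel (by omega), hu]
    refine hold ⟨u, by omega⟩ x ?_
    rw [hCe, Finset.mem_toLeft, List.mem_toFinset, mem_walkList]
    exact ⟨i, by simp only; omega, hu⟩
  · push Not at hx
    exact hnew x (Finset.mem_filter.mpr ⟨Finset.mem_univ _, x, rfl, hxT, fun u i => hx i u⟩)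

/-- The upper bound: no realization has a controllability matrix of larger rank than the number of
states that some cactus structure family essentially covers. -/
theorem rank_ctrbMatrix_le_maxEssCount {n m : ℕ} {A : StructuredMatrix n n}
    {B : StructuredMatrix n m} {A' : Matrix (Fin n) (Fin n) ℝ} {B' : Matrix (Fin n) (Fin m) ℝ}
    (hA : A.IsRealization A') (hB : B.IsRealization B') (k : ℕ) :
    (ctrbMatrix k A' B').rank ≤ maxEssCount A B := by
  obtain ⟨σ, T, hcard, hT, hσ⟩ := exists_perm_of_rank_ctrbMatrix hA hB k
  obtain ⟨ι, _, C, hC, hcov⟩ := exists_family_of_perm σ T hT hσ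
  let e := (Fintype.equivFin ι).symm
  let F : CactusStructureFamily A B :=
    ⟨Fintype.card ι, fun i => C (e i), fun i j hij => hC (e.injective.ne hij)⟩
  refine le_trans ?_ ((maxEssCount_isGreatest A B).2 ⟨F, rfl⟩)
  have hsub : Tᶜ ⊆ Finset.univ.biUnion fun i => (F.member i).essCovered := by
    intro x hx
    obtain ⟨j, hj⟩ := hcov x (Finset.mem_compl.mp hx)
    refine Finset.mem_biUnion.mpr ⟨e.symm j, Finset.mem_univ _, ?_⟩
    change x ∈ (C (e (e.symm j))).essCovered
    rwa [e.apply_symm_apply]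
  have h1 := (Finset.card_le_card hsub).trans Finset.card_biUnion_le
  rw [Finset.card_compl, Fintype.card_fin] at h1
  unfold CactusStructureFamily.essCount
  omega

/-! ### Power series with a new pole -/

/-- A pole that a finite-dimensional space of series does not see: for a suitable `c`, no
nonzero multiple `b * y / (1 - c * X ^ l)` with `deg b < l` lies in `V`. Otherwise more than `dim V`
values of `c` would give such elements of `V`, and these are linearly independent because the
denominators are pairwise coprime. -/
theorem exists_pole_avoiding (V : Submodule ℝ (PowerSeries ℝ)) [FiniteDimensional ℝ V]
    {y : PowerSeries ℝ} (hy : y ≠ 0) (l : ℕ) :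
    ∃ c : ℝ, ∀ o ∈ V, ∀ b : Polynomial ℝ, b.degree < l →
      (1 - PowerSeries.C c * PowerSeries.X ^ l) * o = (b : PowerSeries ℝ) * y → b = 0 := by
  by_contra hcon
  push Not at hcon
  choose o hoV b hdeg hob hb using hcon
  let s : Fin (Module.finrank ℝ V + 1) → ℝ := fun i => (i : ℝ) + 1
  have hs0 : ∀ i, s i ≠ 0 := fun i => by positivity
  have hsinj : Function.Injective s := by
    intro i j hij
    have : (i : ℝ) = (j : ℝ) := add_right_cancel hij
    exact Fin.ext (by exact_mod_cast this)
  let q : ℝ → Polynomial ℝ := fun c => 1 - Polynomial.C c * Polynomial.X ^ l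
  have hqcoe : ∀ c, ((q c : Polynomial ℝ) : PowerSeries ℝ) =
      1 - PowerSeries.C c * PowerSeries.X ^ l := fun c => by simp [q]
  have hcop : ∀ c d, c ≠ d → IsCoprime (q c) (q d) := by
    intro c d hcd
    have hdc : d - c ≠ 0 := sub_ne_zero.mpr hcd.symm
    refine ⟨Polynomial.C (d / (d - c)), -Polynomial.C (c / (d - c)), ?_⟩
    have h1 : Polynomial.C (d / (d - c)) - Polynomial.C (c / (d - c)) = 1 := by
      rw [← Polynomial.C_sub, ← sub_div, div_self hdc, Polynomial.C_1]
    have h2 : Polynomial.C (d / (d - c)) * Polynomial.C c =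
        Polynomial.C (c / (d - c)) * Polynomial.C d := by
      rw [← Polynomial.C_mul, ← Polynomial.C_mul]
      congr 1
      ring
    simp only [q]
    linear_combination h1 - Polynomial.X ^ l * h2
  have hli : LinearIndependent ℝ fun i => (⟨o (s i), hoV (s i)⟩ : V) := by
    rw [Fintype.linearIndependent_iff]
    intro a ha i
    have ha' : ∑ j, PowerSeries.C (a j) * o (s j) = 0 := by
      have := congrArg Subtype.val ha
      simpa [PowerSeries.smul_eq_C_mul] using this
    have hpoly : ∑ j, Polynomial.C (a j) * b (s j) * ∏ k ∈ Finset.univ.erase j, q (s k) = 0 := by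
      apply Polynomial.coe_injective ℝ
      rw [Polynomial.coe_zero]
      refine (mul_eq_zero.mp ?_).resolve_right hy
      rw [← mul_zero ((∏ k, q (s k) : Polynomial ℝ) : PowerSeries ℝ), ← ha', Finset.mul_sum,
        ← Polynomial.coeToPowerSeries.ringHom_apply, map_sum, Finset.sum_mul]
      refine Finset.sum_congr rfl fun j _ => ?_
      rw [← Finset.mul_prod_erase Finset.univ _ (Finset.mem_univ j)]
      simp only [Polynomial.coeToPowerSeries.ringHom_apply, Polynomial.coe_mul, Polynomial.coe_C]
      have := hob (s j)
      rw [← hqcoe] at this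
      linear_combination (-PowerSeries.C (a j) *
        ((∏ k ∈ Finset.univ.erase j, q (s k) : Polynomial ℝ) : PowerSeries ℝ)) * this
    have hdvd : q (s i) ∣ Polynomial.C (a i) * b (s i) := by
      have hcop' : IsCoprime (q (s i)) (∏ k ∈ Finset.univ.erase i, q (s k)) :=
        IsCoprime.prod_right fun k hk => hcop _ _ (hsinj.ne (Finset.ne_of_mem_erase hk).symm)
      refine hcop'.dvd_of_dvd_mul_right ?_
      rw [← Finset.add_sum_erase _ _ (Finset.mem_univ i)] at hpoly
      rw [eq_neg_of_add_eq_zero_left hpoly, dvd_neg]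
      refine Finset.dvd_sum fun j hj => Dvd.dvd.mul_left (Finset.dvd_prod_of_mem _ ?_) _
      exact Finset.mem_erase.mpr ⟨(Finset.ne_of_mem_erase hj).symm, Finset.mem_univ _⟩
    have hl : 0 < l := by
      rcases Nat.eq_zero_or_pos l with rfl | hl
      · exact absurd (Polynomial.degree_eq_bot.mp (by simpa using hdeg (s i))) (hb (s i))
      · exact hl
    have hqdeg : (q (s i)).degree = l := by
      have h1 : (Polynomial.C (s i) * Polynomial.X ^ l).degree = (l : WithBot ℕ) :=
        Polynomial.degree_C_mul_X_pow l (hs0 i)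
      have h2 : (1 : Polynomial ℝ).degree < (Polynomial.C (s i) * Polynomial.X ^ l).degree := by
        rw [h1, Polynomial.degree_one]
        exact_mod_cast hl
      exact (Polynomial.degree_sub_eq_right_of_degree_lt h2).trans h1
    have h0 : Polynomial.C (a i) * b (s i) = 0 := by
      refine Polynomial.eq_zero_of_dvd_of_degree_lt hdvd ?_
      rw [hqdeg]
      rw [← Polynomial.smul_eq_C_mul]
      exact (Polynomial.degree_smul_le _ _).trans_lt (hdeg (s i))
    simpa [hb (s i)] using h0
  have := hli.fintype_card_le_finrank
  rw [Fintype.card_fin] at this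
  omega

/-! ### Responses of a weighted digraph to one input -/

/-- A weighting of the edges inside `N`, given together with the power series by which the nodes
respond to the input `u`: the series of `u` is `1`, and passing along an edge multiplies by `X`
times the weight. If the weights are put into matrices `A'`, `B'`, then the series of the state `i`
is `∑ t, (A' ^ t * B') i u * X ^ (t + 1)`. The nodes of `N` are exactly those that respond. -/
structure InputResponse {n m : ℕ} (A : StructuredMatrix n n) (B : StructuredMatrix n m)
    (N : Finset (SysNode n m)) (u : Fin m) where
  /-- The weight of the edge from the first node to the second. -/
  weight : SysNode n m → SysNode n m → ℝ
  /-- The response of a node. -/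
  series : SysNode n m → PowerSeries ℝ
  adj : ∀ v w, weight v w ≠ 0 → (systemDigraph A B).Adj v w ∧ v ∈ N ∧ w ∈ N
  root : series (Sum.inr u) = 1
  step : ∀ v, v ≠ Sum.inr u →
    series v = PowerSeries.X * ∑ w, PowerSeries.C (weight w v) * series w
  ne_zero : ∀ v ∈ N, series v ≠ 0
  eq_zero : ∀ v, v ∉ N → series v = 0

/-- The responses of the states in `S` are linearly independent. -/
def InputResponse.IndepOn {n m : ℕ} {A : StructuredMatrix n n} {B : StructuredMatrix n m}
    {N : Finset (SysNode n m)} {u : Fin m} (s : InputResponse A B N u) (S : Finset (Fin n)) :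
    Prop :=
  ∀ a : Fin n → ℝ, ∑ i ∈ S, PowerSeries.C (a i) * s.series (Sum.inl i) = 0 → ∀ i ∈ S, a i = 0

theorem InputResponse.root_mem {n m : ℕ} {A : StructuredMatrix n n} {B : StructuredMatrix n m}
    {N : Finset (SysNode n m)} {u : Fin m} (s : InputResponse A B N u) : Sum.inr u ∈ N := by
  by_contra h
  exact one_ne_zero (s.root.symm.trans (s.eq_zero _ h))

/-- Fresh nodes `M` can be added with any weights on edges into `M` and any responses that satisfy
the recursion; the responses of the old nodes do not change. -/
theorem InputResponse.exists_extend {n m : ℕ} {A : StructuredMatrix n n}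
    {B : StructuredMatrix n m} {N : Finset (SysNode n m)} {u : Fin m}
    (s : InputResponse A B N u) {M N' : Finset (SysNode n m)} (hMN : Disjoint M N)
    (hN' : N ∪ M = N') (ω : SysNode n m → SysNode n m → ℝ) (Z : SysNode n m → PowerSeries ℝ)
    (hZ : ∀ v ∈ M, Z v ≠ 0)
    (hω : ∀ v, ∀ w ∈ M, ω v w ≠ 0 → (systemDigraph A B).Adj v w ∧ v ∈ N ∪ M)
    (hstep : ∀ v ∈ M, Z v = PowerSeries.X *
      ∑ w, PowerSeries.C (ω w v) * if w ∈ M then Z w else s.series w) :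
    ∃ s' : InputResponse A B N' u,
      (∀ v ∈ N, s'.series v = s.series v) ∧ ∀ v ∈ M, s'.series v = Z v := by
  subst hN'
  have hdisj : ∀ v ∈ M, v ∉ N := fun v hM hN => Finset.disjoint_left.mp hMN hM hN
  refine ⟨⟨fun v w => if w ∈ M then ω v w else s.weight v w,
    fun v => if v ∈ M then Z v else s.series v, fun v w hvw => ?_, ?_, fun v hv => ?_,
    fun v hv => ?_, fun v hv => ?_⟩, fun v hv => if_neg fun h => hdisj v h hv,
    fun v hv => if_pos hv⟩
  · split_ifs at hvw with hw
    · exact ⟨(hω v w hw hvw).1, (hω v w hw hvw).2, Finset.mem_union_right _ hw⟩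
    · obtain ⟨h1, h2, h3⟩ := s.adj v w hvw
      exact ⟨h1, Finset.mem_union_left _ h2, Finset.mem_union_left _ h3⟩
  · rw [if_neg fun h => hdisj _ h s.root_mem, s.root]
  · split_ifs with hvM
    · exact hstep v hvM
    · rw [s.step v hv]
      congr 1
      refine Finset.sum_congr rfl fun w _ => ?_
      split_ifs with hwM
      · have : s.weight w v = 0 := by
          by_contra h
          exact hdisj w hwM (s.adj w v h).2.1
        simp [this]
      · rfl
  · split_ifs with hvM
    · exact hZ v hvM
    · exact s.ne_zero v ((Finset.mem_union.mp hv).resolve_right hvM)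
  · rw [Finset.mem_union, not_or] at hv
    rw [if_neg hv.2, s.eq_zero v hv.1]

theorem InputResponse.exists_insert {n m : ℕ} {A : StructuredMatrix n n}
    {B : StructuredMatrix n m} {N N' : Finset (SysNode n m)} {u : Fin m}
    (s : InputResponse A B N u) {v w : SysNode n m} (hv : v ∈ N) (hw : w ∉ N)
    (hvw : (systemDigraph A B).Adj v w) (hN' : N ∪ {w} = N') :
    ∃ s' : InputResponse A B N' u,
      (∀ x ∈ N, s'.series x = s.series x) ∧ s'.series w = PowerSeries.X * s.series v := by
  have hne : v ≠ w := fun h => hw (h ▸ hv)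
  obtain ⟨s', hs', hs''⟩ := s.exists_extend (Finset.disjoint_singleton_left.mpr hw) hN'
    (fun a _ => if a = v then 1 else 0) (fun _ => PowerSeries.X * s.series v)
    (fun _ _ => mul_ne_zero PowerSeries.X_ne_zero (s.ne_zero v hv))
    (fun a b hb hab => by
      rw [Finset.mem_singleton] at hb
      have hav : a = v := by
        by_contra h
        exact hab (if_neg h)
      rw [hav, hb]
      exact ⟨hvw, Finset.mem_union_left _ hv⟩)
    (fun b _ => by
      rw [Finset.sum_eq_single v]
      · simp [hne]
      · intro a _ hav
        simp [hav]
      · simp)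
  exact ⟨s', hs', hs'' w (Finset.mem_singleton_self w)⟩

theorem InputResponse.exists_extend_path {n m : ℕ} {A : StructuredMatrix n n}
    {B : StructuredMatrix n m} {u : Fin m} (p : List (SysNode n m))
    (hp : p.IsChain (systemDigraph A B).Adj) {N N' : Finset (SysNode n m)}
    (s : InputResponse A B N u) (hhead : ∀ v ∈ p.head?, v ∈ N) (hN' : N ∪ p.toFinset = N') :
    ∃ s' : InputResponse A B N' u, ∀ x ∈ N, s'.series x = s.series x := by
  induction p generalizing N with
  | nil =>
    rw [List.toFinset_nil, Finset.union_empty] at hN'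
    subst hN'
    exact ⟨s, fun _ _ => rfl⟩
  | cons a p ih =>
    have ha : a ∈ N := hhead a rfl
    rw [List.isChain_cons] at hp
    rcases p with _ | ⟨b, p⟩
    · have : N = N' := by
        rw [← hN']
        simp [ha]
      subst this
      exact ⟨s, fun _ _ => rfl⟩
    · by_cases hb : b ∈ N
      · refine ih hp.2 s (by simpa using hb) ?_
        rw [← hN']
        ext x
        simp only [List.toFinset_cons, Finset.mem_union, Finset.mem_insert]
        grind
      · obtain ⟨s₁, hs₁, -⟩ := s.exists_insert ha hb (hp.1 b rfl) rfl
        obtain ⟨s₂, hs₂⟩ := ih hp.2 s₁ (by simp) (by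
          rw [← hN']
          ext x
          simp only [List.toFinset_cons, Finset.mem_union, Finset.mem_insert,
            Finset.mem_singleton]
          grind)
        exact ⟨s₂, fun x hx => (hs₂ x (Finset.mem_union_left _ hx)).trans (hs₁ x hx)⟩

/-- Follow a path up to the first node of `c`. -/
theorem InputResponse.exists_extend_path_until {n m : ℕ} {A : StructuredMatrix n n}
    {B : StructuredMatrix n m} {u : Fin m} (c : Finset (SysNode n m)) (p : List (SysNode n m))
    (hp : p.IsChain (systemDigraph A B).Adj) {N : Finset (SysNode n m)}
    (s : InputResponse A B N u) (hc : Disjoint c N) (hhead : ∀ v ∈ p.head?, v ∈ N)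
    (hlast : ∃ w ∈ c, p.getLast? = some w) :
    ∃ N', N ⊆ N' ∧ N' ⊆ N ∪ p.toFinset ∧ Disjoint c N' ∧
      (∃ s' : InputResponse A B N' u, ∀ x ∈ N, s'.series x = s.series x) ∧
      ∃ v ∈ N', ∃ w ∈ c, (systemDigraph A B).Adj v w := by
  induction p generalizing N with
  | nil => simp at hlast
  | cons a p ih =>
    have ha : a ∈ N := hhead a rfl
    rw [List.isChain_cons] at hp
    rcases p with _ | ⟨b, p⟩
    · obtain ⟨w, hw, haw⟩ := hlast
      have : a = w := by simpa using haw
      exact absurd (this ▸ ha) (Finset.disjoint_left.mp hc hw)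
    · rw [List.getLast?_cons_cons] at hlast
      by_cases hbc : b ∈ c
      · exact ⟨N, Finset.Subset.refl _, Finset.subset_union_left, hc, ⟨s, fun _ _ => rfl⟩, a, ha,
          b, hbc, hp.1 b rfl⟩
      by_cases hb : b ∈ N
      · obtain ⟨N', h1, h2, h3⟩ := ih hp.2 s hc (by simpa using hb) hlast
        refine ⟨N', h1, h2.trans ?_, h3⟩
        rw [List.toFinset_cons (a := a)]
        exact Finset.union_subset_union_right (Finset.subset_insert _ _)
      · obtain ⟨s₁, hs₁, -⟩ := s.exists_insert ha hb (hp.1 b rfl) rfl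
        obtain ⟨N', h1, h2, h3, ⟨s', hs'⟩, h5⟩ := ih hp.2 s₁
          (Finset.disjoint_union_right.mpr ⟨hc, Finset.disjoint_singleton_right.mpr hbc⟩)
          (by simp) hlast
        refine ⟨N', Finset.subset_union_left.trans h1, h2.trans ?_, h3,
          ⟨s', fun x hx => (hs' x (Finset.mem_union_left _ hx)).trans (hs₁ x hx)⟩, h5⟩
        intro x
        simp only [List.toFinset_cons, Finset.mem_union, Finset.mem_insert, Finset.mem_singleton]
        grind

theorem exists_inputResponse_root {n m : ℕ} (A : StructuredMatrix n n) (B : StructuredMatrix n m)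
    (u : Fin m) {N : Finset (SysNode n m)} (hN : {Sum.inr u} = N) :
    Nonempty (InputResponse A B N u) := by
  subst hN
  refine ⟨⟨fun _ _ => 0, fun v => if v = Sum.inr u then 1 else 0, fun v w h => absurd rfl h,
    if_pos rfl, fun v hv => by simp [hv], fun v hv => ?_, fun v hv => ?_⟩⟩
  · simp [Finset.mem_singleton.mp hv]
  · exact if_neg fun h => hv (Finset.mem_singleton.mpr h)

/-- With unit weights the `i`-th node of a stem responds by `X ^ i`. -/
theorem exists_inputResponse_stem {n m : ℕ} {A : StructuredMatrix n n} {B : StructuredMatrix n m}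
    {u : Fin m} (p : List (SysNode n m)) (hp : p.IsChain (systemDigraph A B).Adj)
    (hnodup : p.Nodup) (hhead : p.head? = some (Sum.inr u)) {N : Finset (SysNode n m)}
    (hN : p.toFinset = N) :
    ∃ s : InputResponse A B N u, ∀ (i : ℕ) (v : SysNode n m), p[i]? = some v →
      s.series v = PowerSeries.X ^ i := by
  induction p using List.reverseRecOn generalizing N with
  | nil => simp at hhead
  | append_singleton q y ih =>
    rcases q.eq_nil_or_concat with rfl | ⟨q', v, rfl⟩
    · have hy : y = Sum.inr u := by simpa using hhead
      subst hy
      obtain ⟨s⟩ := exists_inputResponse_root A B u (N := N) (by simpa using hN)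
      refine ⟨s, fun i v hi => ?_⟩
      rcases i with _ | i
      · have : Sum.inr u = v := by simpa using hi
        rw [← this, s.root, pow_zero]
      · simp at hi
    · rw [List.concat_eq_append] at *
      rw [List.isChain_append] at hp
      rw [List.nodup_append] at hnodup
      have hyq : y ∉ (q' ++ [v]).toFinset := fun h =>
        hnodup.2.2 y (List.mem_toFinset.mp h) y (by simp) rfl
      obtain ⟨s, hs⟩ := ih hp.1 hnodup.1 (by
        rw [← hhead]
        rcases q' with _ | ⟨a, q'⟩ <;> simp) rfl
      have hvy : (systemDigraph A B).Adj v y := hp.2.2 v (by simp) y (by simp)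
      obtain ⟨s', hs', hsy⟩ := s.exists_insert (v := v) (w := y) (N' := N) (by simp) hyq hvy (by
        rw [← hN, List.toFinset_append (l' := [y])]
        simp)
      refine ⟨s', fun i x hi => ?_⟩
      rw [List.getElem?_append] at hi
      split_ifs at hi with h
      · rw [hs' x (List.mem_toFinset.mpr (List.mem_of_getElem? hi)), hs i x hi]
      · have hlen : (q' ++ [v]).length = q'.length + 1 := by simp
        have hi0 : i = q'.length + 1 := by
          have := (List.getElem?_eq_some_iff.mp hi).1
          simp only [List.length_singleton] at this
          omega
        subst hi0
        have hxy : y = x := by simpa using hi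
        subst hxy
        rw [hsy, hs q'.length v (by simp), pow_succ']

theorem exists_inputResponse_indepOn_stem {n m : ℕ} {A : StructuredMatrix n n}
    {B : StructuredMatrix n m} {p : List (SysNode n m)} (hp : IsStem A B p) :
    ∃ (u : Fin m) (s : InputResponse A B p.toFinset u), s.IndepOn p.toFinset.toLeft := by
  obtain ⟨⟨-, hchain⟩, hnodup, ⟨u, hu⟩, -⟩ := hp
  obtain ⟨s, hs⟩ := exists_inputResponse_stem p hchain hnodup hu rfl
  have hpos : ∀ i : Fin n, ∃ k : ℕ, i ∈ p.toFinset.toLeft →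
      p[k]? = some (Sum.inl i : SysNode n m) := by
    intro i
    by_cases hi : i ∈ p.toFinset.toLeft
    · obtain ⟨k, hk⟩ := List.mem_iff_getElem?.mp
        (List.mem_toFinset.mp (Finset.mem_toLeft.mp hi))
      exact ⟨k, fun _ => hk⟩
    · exact ⟨0, fun h => absurd h hi⟩
  choose k hk using hpos
  refine ⟨u, s, fun a ha i hi => ?_⟩
  have := congrArg (PowerSeries.coeff (k i)) ha
  rw [map_sum, map_zero, Finset.sum_eq_single i] at this
  · simpa [hs _ _ (hk i hi), PowerSeries.coeff_X_pow] using this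
  · intro j hj hji
    rw [hs _ _ (hk j hj), PowerSeries.coeff_C_mul, PowerSeries.coeff_X_pow, if_neg, mul_zero]
    intro h
    have hij := hk j hj
    rw [← h, hk i hi] at hij
    exact hji (Sum.inl.inj (Option.some.inj hij)).symm
  · exact fun h => absurd hi h

/-! ### Responses of the nodes of a cactus structure -/

/-- A cycle through `w`, listed once around from `w`; all its nodes are states. -/
theorem Digraph.IsCycleList.exists_states {n m : ℕ} {A : StructuredMatrix n n}
    {B : StructuredMatrix n m} {c : List (SysNode n m)}
    (hc : (systemDigraph A B).IsCycleList c) {w : SysNode n m} (hw : w ∈ c) :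
    ∃ (l : ℕ) (x : ℕ → Fin n), 1 ≤ l ∧ Set.InjOn x (Set.Iio l) ∧ Sum.inl (x 0) = w ∧ x l = x 0 ∧
      (∀ i, (systemDigraph A B).Adj (Sum.inl (x i)) (Sum.inl (x (i + 1)))) ∧
      c.toFinset = (Finset.range l).image fun i => Sum.inl (x i) := by
  obtain ⟨⟨hlen, hchain⟩, hclosed, hnodup⟩ := hc
  rcases c with _ | ⟨v₀, t⟩
  · simp at hlen
  rw [List.tail_cons] at hnodup
  have hl : 1 ≤ t.length := by simpa using hlen
  set l := t.length
  rw [List.isChain_iff_getElem] at hchain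
  let T : ℕ → SysNode n m := fun j => t[j % l]'(Nat.mod_lt _ hl)
  have hT : ∀ j (hj : j < l), T j = t[j] := fun j hj => by
    simp only [T, Nat.mod_eq_of_lt hj]
  have hlast : T (l - 1) = v₀ := by
    have hne : t ≠ [] := List.ne_nil_of_length_pos hl
    rw [List.head?_cons, List.getLast?_cons, List.getLast?_eq_some_getLast hne] at hclosed
    rw [hT _ (by omega), ← List.getLast_eq_getElem hne]
    simpa using hclosed.symm
  have hmod : ∀ j, T (j % l) = T j := fun j => by simp only [T, Nat.mod_mod]
  have hadj : ∀ j, (systemDigraph A B).Adj (T j) (T (j + 1)) := by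
    intro j
    rw [← hmod j, ← hmod (j + 1), Nat.add_mod, ← Nat.add_mod_mod, Nat.mod_mod]
    have hj := Nat.mod_lt j hl
    set i := j % l
    rcases Nat.lt_or_ge (i + 1) l with h | h
    · have h1 : (i + 1 % l) % l = i + 1 := by
        rw [Nat.add_mod_mod, Nat.mod_eq_of_lt h]
      rw [h1, hT i hj, hT (i + 1) h]
      exact hchain (i + 1) (by simp only [List.length_cons]; omega)
    · have h0 : i = l - 1 := by omega
      have h1 : (i + 1 % l) % l = 0 := by
        rw [Nat.add_mod_mod, h0, Nat.sub_add_cancel hl, Nat.mod_self]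
      rw [h1, h0, hlast, hT 0 hl]
      exact hchain 0 (by simp only [List.length_cons]; omega)
  have hTinj : ∀ i < l, ∀ j < l, T i = T j → i = j := by
    intro i hi j hj hij
    rw [hT i hi, hT j hj] at hij
    exact (List.Nodup.getElem_inj_iff hnodup).mp hij
  have hmem : ∀ v, v ∈ v₀ :: t ↔ ∃ j < l, T j = v := by
    intro v
    rw [List.mem_cons, List.mem_iff_getElem]
    constructor
    · rintro (rfl | ⟨j, hj, rfl⟩)
      · exact ⟨l - 1, by omega, hlast⟩
      · exact ⟨j, hj, hT j hj⟩
    · rintro ⟨j, hj, rfl⟩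
      exact Or.inr ⟨j, hj, (hT j hj).symm⟩
  obtain ⟨j₀, hj₀, hjw⟩ := (hmem w).mp hw
  have hstate : ∀ j, ∃ x : Fin n, T j = Sum.inl x := by
    intro j
    have hper : T (j + (l - 1) + 1) = T j := by
      rw [← hmod, show j + (l - 1) + 1 = j + l by omega, Nat.add_mod_right, hmod]
    rw [← hper]
    exact exists_inl_of_adj (hadj _)
  choose x hx using hstate
  have hxT : ∀ i j, x i = x j → T i = T j := fun i j h => by rw [hx, hx, h]
  refine ⟨l, fun i => x (j₀ + i), hl, fun i hi j hj hij => ?_, ?_, ?_, fun i => ?_, ?_⟩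
  · have h1 := hxT _ _ hij
    rw [← hmod, ← hmod (j₀ + j)] at h1
    have h2 := hTinj _ (Nat.mod_lt _ hl) _ (Nat.mod_lt _ hl) h1
    have h3 : i ≡ j [MOD l] := Nat.ModEq.add_left_cancel' j₀ h2
    exact h3.eq_of_lt_of_lt hi hj
  · rw [← hx, Nat.add_zero, hjw]
  · have : (Sum.inl (x (j₀ + l)) : SysNode n m) = Sum.inl (x (j₀ + 0)) := by
      rw [← hx, ← hx, ← hmod, Nat.add_mod_right, hmod, Nat.add_zero]
    exact Sum.inl.inj this
  · rw [← hx, ← hx]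
    exact hadj _
  · ext v
    simp only [← hx]
    rw [List.mem_toFinset, hmem, Finset.mem_image]
    constructor
    · rintro ⟨j, hj, rfl⟩
      refine ⟨(j + (l - j₀)) % l, Finset.mem_range.mpr (Nat.mod_lt _ hl), ?_⟩
      rw [← hmod, Nat.add_mod_mod, show j₀ + (j + (l - j₀)) = j + l by omega, Nat.add_mod_right,
        hmod]
    · rintro ⟨i, -, rfl⟩
      exact ⟨_, Nat.mod_lt (j₀ + i) hl, hmod _⟩

/-- Adding a cycle `x 0, ..., x (l - 1)` behind an edge from `v` to `x 0`. With unit weights except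
`c` on the closing edge, `x j` responds by `X ^ j * y`, where `(1 - c * X ^ l) * y` is `X` times the
response of `v`; `exists_pole_avoiding` chooses `c` so that independence persists. -/
theorem InputResponse.exists_extend_cycle {n m : ℕ} {A : StructuredMatrix n n}
    {B : StructuredMatrix n m} {N N' : Finset (SysNode n m)} {u : Fin m}
    (s : InputResponse A B N u) {S : Finset (Fin n)} (hS : s.IndepOn S) (hSN : S ⊆ N.toLeft)
    {l : ℕ} (hl : 1 ≤ l) {x : ℕ → Fin n} (hx : Set.InjOn x (Set.Iio l)) (hxl : x l = x 0)
    (hadj : ∀ i, (systemDigraph A B).Adj (Sum.inl (x i)) (Sum.inl (x (i + 1))))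
    {c : Finset (SysNode n m)} (hc : c = (Finset.range l).image fun i => Sum.inl (x i))
    (hcN : Disjoint c N) {v : SysNode n m} (hv : v ∈ N)
    (hvx : (systemDigraph A B).Adj v (Sum.inl (x 0))) (hN' : N ∪ c = N') :
    ∃ s' : InputResponse A B N' u,
      (∀ w ∈ N, s'.series w = s.series w) ∧ s'.IndepOn (S ∪ c.toLeft) := by
  have hy : PowerSeries.X * s.series v ≠ 0 := mul_ne_zero PowerSeries.X_ne_zero (s.ne_zero v hv)
  let V : Submodule ℝ (PowerSeries ℝ) :=
    Submodule.span ℝ ((fun i => s.series (Sum.inl i)) '' S)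
  have : FiniteDimensional ℝ V :=
    FiniteDimensional.span_of_finite ℝ (S.finite_toSet.image _)
  obtain ⟨r, hr⟩ := exists_pole_avoiding V hy l
  set q : PowerSeries ℝ := 1 - PowerSeries.C r * PowerSeries.X ^ l with hq
  have hq0 : PowerSeries.constantCoeff q ≠ 0 := by
    simp [hq, show l ≠ 0 by omega]
  set y : PowerSeries ℝ := q⁻¹ * (PowerSeries.X * s.series v) with hydef
  have hqy : q * y = PowerSeries.X * s.series v := by
    rw [hydef, ← mul_assoc, PowerSeries.mul_inv_cancel q hq0, one_mul]
  have hyne : y ≠ 0 := fun h => hy (by rw [← hqy, h, mul_zero])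
  have hmem : ∀ w, w ∈ c ↔ ∃ i < l, Sum.inl (x i) = w := fun w => by
    rw [hc, Finset.mem_image]
    simp only [Finset.mem_range]
  -- The position of a node on the cycle, and its predecessor there.
  have hidx : ∃ idx : SysNode n m → ℕ, ∀ i < l, idx (Sum.inl (x i)) = i := by
    have hinj : Set.InjOn (fun i => (Sum.inl (x i) : SysNode n m)) (Set.Iio l) :=
      fun i hi j hj hij => hx hi hj (Sum.inl.inj hij)
    exact ⟨Function.invFunOn (fun i => Sum.inl (x i)) (Set.Iio l),
      fun i hi => hinj.leftInvOn_invFunOn hi⟩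
  obtain ⟨idx, hidx⟩ := hidx
  let pre : SysNode n m → SysNode n m := fun w =>
    Sum.inl (x (if idx w = 0 then l - 1 else idx w - 1))
  have hprelt : ∀ i < l, (if i = 0 then l - 1 else i - 1) < l := fun i hi => by
    split_ifs <;> omega
  have hpre : ∀ i < l, (systemDigraph A B).Adj (pre (Sum.inl (x i))) (Sum.inl (x i)) := by
    intro i hi
    simp only [pre, hidx i hi]
    split_ifs with h
    · have := hadj (l - 1)
      rwa [Nat.sub_add_cancel hl, hxl, ← h] at this
    · have := hadj (i - 1)
      rwa [Nat.sub_add_cancel (by omega)] at this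
  have hpremem : ∀ i < l, pre (Sum.inl (x i)) ∈ c := fun i hi => by
    simp only [pre, hidx i hi]
    exact (hmem _).mpr ⟨_, hprelt i hi, rfl⟩
  obtain ⟨s', hs', hs''⟩ := s.exists_extend hcN hN'
    (fun a b => (if a = pre b then (if idx b = 0 then r else 1) else 0) +
      if a = v then (if idx b = 0 then 1 else 0) else 0)
    (fun b => PowerSeries.X ^ idx b * y)
    (fun _ _ => mul_ne_zero (pow_ne_zero _ PowerSeries.X_ne_zero) hyne)
    (fun a b hb hab => by
      obtain ⟨i, hi, rfl⟩ := (hmem b).mp hb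
      rw [hidx i hi] at hab
      by_cases hap : a = pre (Sum.inl (x i))
      · rw [hap]
        exact ⟨hpre i hi, Finset.mem_union_right _ (hpremem i hi)⟩
      · rw [if_neg hap, zero_add] at hab
        have hav : a = v := by
          by_contra h
          exact hab (if_neg h)
        have hi0 : i = 0 := by
          by_contra h
          exact hab (by rw [if_neg h, ite_self])
        rw [hav, hi0]
        exact ⟨hvx, Finset.mem_union_left _ hv⟩)
    (fun b hb => by
      obtain ⟨i, hi, rfl⟩ := (hmem b).mp hb
      have hvc : v ∉ c := fun h => Finset.disjoint_left.mp hcN h hv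
      simp only [map_add, add_mul, Finset.sum_add_distrib, apply_ite PowerSeries.C, map_zero,
        ite_mul, zero_mul, Finset.sum_ite_eq', Finset.mem_univ, if_true,
        if_pos (hpremem i hi), if_neg hvc, map_one, one_mul]
      simp only [pre, hidx i hi, hidx _ (hprelt i hi)]
      split_ifs with h
      · obtain ⟨l, rfl⟩ := Nat.exists_eq_add_of_le' hl
        rw [h, Nat.add_sub_cancel]
        linear_combination hqy - hq * y
      · obtain ⟨i, rfl⟩ := Nat.exists_eq_succ_of_ne_zero h
        rw [Nat.succ_sub_one, pow_succ']
        ring)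
  refine ⟨s', hs', fun a ha => ?_⟩
  have hdisj : Disjoint S c.toLeft := by
    rw [Finset.disjoint_left]
    intro i hi hic
    exact Finset.disjoint_left.mp hcN (Finset.mem_toLeft.mp hic) (Finset.mem_toLeft.mp (hSN hi))
  have hcl : c.toLeft = (Finset.range l).image x := by
    ext i
    rw [Finset.mem_toLeft, hmem, Finset.mem_image]
    simp only [Finset.mem_range, Sum.inl.injEq]
  let o : PowerSeries ℝ := ∑ i ∈ S, PowerSeries.C (a i) * s.series (Sum.inl i)
  let b : Polynomial ℝ := ∑ j ∈ Finset.range l, Polynomial.C (a (x j)) * Polynomial.X ^ j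
  have hsum : o + (b : PowerSeries ℝ) * y = 0 := by
    rw [Finset.sum_union hdisj, hcl, Finset.sum_image (by simpa using hx)] at ha
    rw [← ha]
    congr 1
    · refine Finset.sum_congr rfl fun i hi => ?_
      rw [hs' _ (Finset.mem_toLeft.mp (hSN hi))]
    · simp only [b, ← Polynomial.coeToPowerSeries.ringHom_apply, map_sum]
      rw [Finset.sum_mul]
      refine Finset.sum_congr rfl fun j hj => ?_
      have hj' := Finset.mem_range.mp hj
      rw [hs'' _ ((hmem _).mpr ⟨j, hj', rfl⟩), hidx j hj']
      simp only [Polynomial.coeToPowerSeries.ringHom_apply, Polynomial.coe_mul, Polynomial.coe_C,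
        Polynomial.coe_pow, Polynomial.coe_X]
      ring
  have hoV : o ∈ V := Submodule.sum_mem _ fun i hi => by
    rw [← PowerSeries.smul_eq_C_mul]
    exact V.smul_mem _ (Submodule.subset_span ⟨i, hi, rfl⟩)
  have hbdeg : (-b).degree < l := by
    rw [Polynomial.degree_neg]
    rw [← Polynomial.mem_degreeLT]
    refine Submodule.sum_mem _ fun j hj => Polynomial.mem_degreeLT.mpr ?_
    exact (Polynomial.degree_C_mul_X_pow_le j _).trans_lt
      (by exact_mod_cast Finset.mem_range.mp hj)
  have hb : -b = 0 := hr o hoV (-b) hbdeg (by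
    rw [← hqy, Polynomial.coe_neg]
    linear_combination q * hsum)
  rw [neg_eq_zero] at hb
  rw [hb, Polynomial.coe_zero, zero_mul, add_zero] at hsum
  intro i hi
  rcases Finset.mem_union.mp hi with hi | hi
  · exact hS a hsum i hi
  · rw [hcl] at hi
    obtain ⟨j, hj, rfl⟩ := Finset.mem_image.mp hi
    have := congrArg (fun p => Polynomial.coeff p j) hb
    simpa [b, Polynomial.finsetSum_coeff, Finset.mem_range.mp hj] using this

/-- Every cactus structure carries weights for which the states that it essentially covers respond
linearly independently to its root. -/
theorem IsCactusStructure.exists_inputResponse {n m : ℕ} {A : StructuredMatrix n n}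
    {B : StructuredMatrix n m} {N : Finset (SysNode n m)}
    {E : Finset (SysNode n m × SysNode n m)} {S : Finset (Fin n)}
    (h : IsCactusStructure A B N E S) :
    ∃ (u : Fin m) (s : InputResponse A B N u), s.IndepOn S := by
  induction h with
  | stem p hp => exact exists_inputResponse_indepOn_stem hp
  | attach N E S former c hc hcN p hp hstart hend hpE ih =>
    obtain ⟨u, s, hs⟩ := ih
    obtain ⟨v₀, hv₀, hpv₀⟩ := hstart
    have hhead : ∀ v ∈ p.head?, v ∈ N := fun v hv => by
      rw [hpv₀] at hv
      rwa [← Option.some.inj hv]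
    obtain ⟨N₁, hN₁, hN₁', hcN₁, ⟨s₁, hs₁⟩, v, hv, w, hw, hvw⟩ :=
      s.exists_extend_path_until c.toFinset p hp.2 hcN hhead (by simpa using hend)
    have hSN := former.subset_toLeft
    obtain ⟨l, x, hl, hx, hxw, hxl, hadj, hcx⟩ := hc.exists_states (List.mem_toFinset.mp hw)
    have hs₁S : s₁.IndepOn S := by
      intro a ha
      refine hs a ?_
      rw [← ha]
      refine Finset.sum_congr rfl fun i hi => ?_
      rw [hs₁ _ (Finset.mem_toLeft.mp (hSN hi))]
    obtain ⟨s₂, -, hs₂S⟩ := s₁.exists_extend_cycle hs₁S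
      (hSN.trans (Finset.toLeft_subset_toLeft hN₁)) hl hx hxl hadj hcx hcN₁ hv (hxw ▸ hvw) rfl
    -- The part of the path behind the entry into the cycle still has to be covered.
    obtain ⟨s₃, hs₃⟩ := s₂.exists_extend_path p hp.2
      (fun v hv => Finset.mem_union_left _ (hN₁ (hhead v hv)))
      (N' := N ∪ p.toFinset ∪ c.toFinset) (by
        ext v
        have h1 := @hN₁ v
        have h2 := @hN₁' v
        simp only [Finset.mem_union] at h2 ⊢
        tauto)
    refine ⟨u, s₃, fun a ha => hs₂S a ?_⟩
    rw [← ha]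
    refine Finset.sum_congr rfl fun i hi => ?_
    rw [hs₃]
    rcases Finset.mem_union.mp hi with hi | hi
    · exact Finset.mem_union_left _ (hN₁ (Finset.mem_toLeft.mp (hSN hi)))
    · exact Finset.mem_union_right _ (Finset.mem_toLeft.mp hi)

/-! ### Krylov sequences and the structural controllability index -/

/-- If a Krylov vector depends on the earlier ones, then so do all later ones. -/
theorem pow_apply_mem_span_of_mem_span {K E : Type*} [Field K] [AddCommGroup E] [Module K E]
    (f : Module.End K E) (b : E) {t : ℕ}
    (h : (f ^ t) b ∈ Submodule.span K (Set.range fun i : Fin t => (f ^ (i : ℕ)) b)) (s : ℕ) :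
    (f ^ s) b ∈ Submodule.span K (Set.range fun i : Fin t => (f ^ (i : ℕ)) b) := by
  set V := Submodule.span K (Set.range fun i : Fin t => (f ^ (i : ℕ)) b)
  have hlt : ∀ i < t, (f ^ i) b ∈ V := fun i hi => Submodule.subset_span ⟨⟨i, hi⟩, rfl⟩
  have hV : V ≤ V.comap f := by
    rw [Submodule.span_le]
    rintro _ ⟨i, rfl⟩
    change f ((f ^ (i : ℕ)) b) ∈ V
    rw [← Module.End.mul_apply, ← pow_succ']
    rcases Nat.lt_or_ge (i + 1) t with hi | hi
    · exact hlt _ hi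
    · rwa [show (i : ℕ) + 1 = t by omega]
  induction s with
  | zero =>
    rcases Nat.eq_zero_or_pos t with rfl | ht
    · exact h
    · exact hlt 0 ht
  | succ s ih =>
    rw [pow_succ', Module.End.mul_apply]
    exact hV ih

/-- If no nontrivial functional supported on `S` kills the whole Krylov sequence, then its first
`#S` vectors are linearly independent. -/
theorem linearIndependent_pow_apply {K ι : Type*} [Field K] (f : Module.End K (ι → K))
    (b : ι → K) (S : Finset ι)
    (hS : ∀ a : ι → K, (∀ t, ∑ i ∈ S, a i * (f ^ t) b i = 0) → ∀ i ∈ S, a i = 0) :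
    ∀ d ≤ S.card, LinearIndependent K fun t : Fin d => (f ^ (t : ℕ)) b := by
  classical
  intro d
  induction d with
  | zero => exact fun _ => linearIndependent_empty_type
  | succ d ih =>
    intro hd
    have hsnoc : (fun t : Fin (d + 1) => (f ^ (t : ℕ)) b) =
        Fin.snoc (α := fun _ => ι → K) (fun t : Fin d => (f ^ (t : ℕ)) b) ((f ^ d) b) := by
      funext t
      refine Fin.lastCases ?_ (fun i => ?_) t <;> simp
    rw [hsnoc, linearIndependent_finSnoc]
    refine ⟨ih (by omega), fun hmem => ?_⟩
    have hall := pow_apply_mem_span_of_mem_span f b hmem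
    set V := Submodule.span K (Set.range fun i : Fin d => (f ^ (i : ℕ)) b)
    let ρ : (ι → K) →ₗ[K] (S → K) := LinearMap.funLeft K K Subtype.val
    have hVd : Module.finrank K (V.map ρ) ≤ d := by
      have h1 : Module.Finite K V := Module.Finite.span_of_finite K (Set.finite_range _)
      have h2 : Module.finrank K V ≤ Fintype.card (Fin d) := finrank_range_le_card _
      rw [Fintype.card_fin] at h2
      exact (Submodule.finrank_map_le ρ V).trans h2
    have hlt : V.map ρ < ⊤ := by
      rw [lt_top_iff_ne_top]
      intro h
      rw [h, finrank_top, Module.finrank_fintype_fun_eq_card, Fintype.card_coe] at hVd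
      omega
    obtain ⟨φ, hφ0, hφ⟩ := Submodule.exists_le_ker_of_lt_top _ hlt
    have hφsum : ∀ x : S → K, φ x = ∑ i, φ (Pi.single i 1) * x i := by
      intro x
      conv_lhs => rw [pi_eq_sum_univ' x]
      simp [mul_comm]
    let a : ι → K := fun i => if h : i ∈ S then φ (Pi.single ⟨i, h⟩ 1) else 0
    have ha : ∀ i : S, a i = φ (Pi.single i 1) := fun i => dif_pos i.2
    have hzero := hS a fun t => by
      have h0 : φ (ρ ((f ^ t) b)) = 0 := hφ (Submodule.mem_map_of_mem (hall t))
      rw [hφsum] at h0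
      rw [← h0, ← Finset.sum_coe_sort]
      exact Finset.sum_congr rfl fun i _ => by rw [ha]; rfl
    apply hφ0
    ext x
    simp [← ha, hzero]

theorem InputResponse.series_inr_of_ne {n m : ℕ} {A : StructuredMatrix n n}
    {B : StructuredMatrix n m} {N : Finset (SysNode n m)} {u : Fin m}
    (s : InputResponse A B N u) {w : Fin m} (hw : w ≠ u) : s.series (Sum.inr w) = 0 := by
  rw [s.step _ (fun h => hw (Sum.inr.inj h)), Finset.sum_eq_zero, mul_zero]
  intro v _
  have : s.weight v (Sum.inr w) = 0 := by
    by_contra h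
    obtain ⟨x, hx⟩ := exists_inl_of_adj (s.adj v _ h).1
    cases hx
  rw [this, map_zero, zero_mul]

/-- Weights on disjoint node sets, put into one realization, do not interfere: the Krylov sequence
of the input `u r` is read off from the responses to `u r` alone. -/
theorem pow_mul_apply_eq_coeff {n m : ℕ} {A : StructuredMatrix n n} {B : StructuredMatrix n m}
    {ι : Type*} [Fintype ι] {N : ι → Finset (SysNode n m)}
    (hN : ∀ q r, q ≠ r → Disjoint (N q) (N r)) {u : ι → Fin m}
    (s : ∀ r, InputResponse A B (N r) (u r)) (t : ℕ) (i : Fin n) (r : ι) :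
    ((Matrix.of fun i j => ∑ q, (s q).weight (Sum.inl j) (Sum.inl i)) ^ t *
      (Matrix.of fun i w => ∑ q, (s q).weight (Sum.inr w) (Sum.inl i) :
        Matrix (Fin n) (Fin m) ℝ)) i (u r) =
      PowerSeries.coeff (t + 1) ((s r).series (Sum.inl i)) := by
  have hweight : ∀ v w, v ∈ N r → ∑ q, (s q).weight v w = (s r).weight v w := by
    intro v w hv
    refine Finset.sum_eq_single r (fun q _ hqr => ?_) (fun h => absurd (Finset.mem_univ _) h)
    by_contra h
    exact Finset.disjoint_left.mp (hN q r hqr) ((s q).adj v w h).2.1 hv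
  have hstep : ∀ t i, PowerSeries.coeff (t + 1) ((s r).series (Sum.inl i)) =
      ∑ j, (s r).weight (Sum.inl j) (Sum.inl i) *
        PowerSeries.coeff t ((s r).series (Sum.inl j)) +
      (s r).weight (Sum.inr (u r)) (Sum.inl i) * if t = 0 then 1 else 0 := by
    intro t i
    rw [(s r).step _ Sum.inl_ne_inr, PowerSeries.coeff_succ_X_mul, map_sum]
    simp only [PowerSeries.coeff_C_mul, Fintype.sum_sum_type]
    congr 1
    rw [Finset.sum_eq_single (u r)]
    · rw [(s r).root, PowerSeries.coeff_one]
    · intro w _ hw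
      rw [(s r).series_inr_of_ne hw, map_zero, mul_zero]
    · exact fun h => absurd (Finset.mem_univ _) h
  induction t generalizing i with
  | zero =>
    rw [pow_zero, Matrix.one_mul, hstep, Matrix.of_apply, hweight _ _ (s r).root_mem]
    rw [Finset.sum_eq_zero, if_pos rfl, zero_add, mul_one]
    intro j _
    rw [(s r).step _ Sum.inl_ne_inr, PowerSeries.coeff_zero_X_mul, mul_zero]
  | succ t ih =>
    rw [pow_succ', Matrix.mul_assoc, Matrix.mul_apply, hstep, if_neg (Nat.succ_ne_zero t),
      mul_zero, add_zero]
    refine Finset.sum_congr rfl fun j _ => ?_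
    rw [ih, Matrix.of_apply]
    by_cases hj : Sum.inl j ∈ N r
    · rw [hweight _ _ hj]
    · rw [(s r).eq_zero _ hj, map_zero, mul_zero, mul_zero]

/-- The lower bound: within `k` steps each member of a family contributes all the states that it
essentially covers, or at least `k`. -/
theorem sum_min_le_ctrbGenericRank {n m : ℕ} {A : StructuredMatrix n n} {B : StructuredMatrix n m}
    (F : CactusStructureFamily A B) (k : ℕ) :
    ∑ i, min (F.member i).essCovered.card k ≤ ctrbGenericRank A B k := by
  choose u s hs using fun r => (F.member r).isCactusStructure.exists_inputResponse
  let A' : Matrix (Fin n) (Fin n) ℝ :=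
    Matrix.of fun i j => ∑ q, (s q).weight (Sum.inl j) (Sum.inl i)
  let B' : Matrix (Fin n) (Fin m) ℝ :=
    Matrix.of fun i w => ∑ q, (s q).weight (Sum.inr w) (Sum.inl i)
  have hcoeff : ∀ t i r, (A' ^ t * B') i (u r) =
      PowerSeries.coeff (t + 1) ((s r).series (Sum.inl i)) :=
    fun t i r => pow_mul_apply_eq_coeff F.disjoint s t i r
  have hpow : ∀ r t, (A'.toLin' ^ t) (B'.col (u r)) = (A' ^ t * B').col (u r) := by
    intro r t
    rw [← Matrix.toLin'_pow]
    rfl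
  have hli : ∀ r, LinearIndependent ℝ fun t : Fin (min (F.member r).essCovered.card k) =>
      (A' ^ (t : ℕ) * B').col (u r) := by
    intro r
    have := linearIndependent_pow_apply A'.toLin' (B'.col (u r)) (F.member r).essCovered
      (fun a ha => hs r a ?_) _ (min_le_left _ k)
    · simpa only [hpow] using this
    · ext t
      rw [map_sum, map_zero]
      rcases t with _ | t
      · refine Finset.sum_eq_zero fun i _ => ?_
        rw [(s r).step _ Sum.inl_ne_inr, PowerSeries.coeff_C_mul, PowerSeries.coeff_zero_X_mul,
          mul_zero]
      · rw [← ha t]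
        refine Finset.sum_congr rfl fun i _ => ?_
        rw [PowerSeries.coeff_C_mul, hpow, Matrix.col_apply, hcoeff]
  let v : (Σ r, Fin (min (F.member r).essCovered.card k)) → Fin n → ℝ :=
    fun p => (A' ^ (p.2 : ℕ) * B').col (u p.1)
  have hv : LinearIndependent ℝ v := by
    rw [Fintype.linearIndependent_iff]
    rintro g hg ⟨r, t⟩
    refine Fintype.linearIndependent_iff.mp (hli r) (fun t => g ⟨r, t⟩) ?_ t
    -- The columns that belong to `r` live on the nodes of the member `r`.
    ext i
    have hvanish : ∀ q (t : ℕ), Sum.inl i ∉ (F.member q).nodes →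
        (A' ^ t * B').col (u q) i = 0 := fun q t hi => by
      rw [Matrix.col_apply, hcoeff, (s q).eq_zero _ hi, map_zero]
    simp only [Finset.sum_apply, Pi.smul_apply, Pi.zero_apply]
    by_cases hi : Sum.inl i ∈ (F.member r).nodes
    · have hgi := congrFun hg i
      rw [Fintype.sum_sigma] at hgi
      simp only [Finset.sum_apply, Pi.smul_apply, Pi.zero_apply, v] at hgi
      rw [Finset.sum_eq_single r] at hgi
      · exact hgi
      · intro q _ hqr
        refine Finset.sum_eq_zero fun t _ => ?_
        rw [hvanish q t fun h => Finset.disjoint_left.mp (F.disjoint q r hqr) h hi, smul_zero]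
      · exact fun h => absurd (Finset.mem_univ _) h
    · exact Finset.sum_eq_zero fun t _ => by rw [hvanish r t hi, smul_zero]
  have hcard : Fintype.card (Σ r, Fin (min (F.member r).essCovered.card k)) =
      ∑ r, min (F.member r).essCovered.card k := by
    simp
  rw [← hcard, ← finrank_span_eq_card hv]
  refine le_trans ?_ ((ctrbRanks_isGreatest A B k).2 ⟨A', B', fun i j hij => ?_,
    fun i w hiw => ?_, rfl⟩)
  · rw [Matrix.rank_eq_finrank_span_cols]
    apply Submodule.finrank_mono
    rw [Submodule.span_le]
    rintro _ ⟨⟨r, t⟩, rfl⟩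
    exact Submodule.subset_span ⟨(⟨t, t.2.trans_le (min_le_right _ _)⟩, u r), rfl⟩
  · change ∑ q, (s q).weight (Sum.inl j) (Sum.inl i) = 0
    refine Finset.sum_eq_zero fun q _ => ?_
    by_contra h
    exact hij ((s q).adj _ _ h).1
  · change ∑ q, (s q).weight (Sum.inr w) (Sum.inl i) = 0
    refine Finset.sum_eq_zero fun q _ => ?_
    by_contra h
    exact hiw ((s q).adj _ _ h).1

theorem ctrbGenericRank_le_maxEssCount {n m : ℕ} (A : StructuredMatrix n n)
    (B : StructuredMatrix n m) (k : ℕ) : ctrbGenericRank A B k ≤ maxEssCount A B := by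
  obtain ⟨A', B', hA, hB, h⟩ := (ctrbRanks_isGreatest A B k).1
  rw [h]
  exact rank_ctrbMatrix_le_maxEssCount hA hB k

theorem maxEssCount_pos {n m : ℕ} {A : StructuredMatrix n n} {B : StructuredMatrix n m}
    {i : Fin n} {w : Fin m} (h : B i w) : 1 ≤ maxEssCount A B := by
  have hrank : 1 ≤ (ctrbMatrix 1 (0 : Matrix (Fin n) (Fin n) ℝ) (Matrix.single i w 1)).rank := by
    rw [Matrix.rank_eq_finrank_span_cols, Submodule.one_le_finrank_iff, Submodule.ne_bot_iff]
    refine ⟨_, Submodule.subset_span ⟨(0, w), rfl⟩, fun h0 => ?_⟩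
    have := congrFun h0 i
    simp [ctrbMatrix] at this
  refine hrank.trans (rank_ctrbMatrix_le_maxEssCount (fun _ _ _ => rfl) (fun i' w' h' => ?_) 1)
  rw [Matrix.single_apply, if_neg]
  rintro ⟨rfl, rfl⟩
  exact h' h

theorem structuralControllabilityIndex_le_of_isMaximum {n m : ℕ} (hn : 1 ≤ n)
    {A : StructuredMatrix n n} {B : StructuredMatrix n m} {k : ℕ} (hk : 1 ≤ k)
    (F : CactusStructureFamily A B) (hF : F.IsMaximum)
    (hFk : ∀ i, (F.member i).essCovered.card ≤ k) : structuralControllabilityIndex A B ≤ k := by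
  have hleast := structuralControllabilityIndex_isLeast hn A B
  rcases Nat.lt_or_ge n k with hnk | hkn
  · exact hleast.1.2.1.trans hnk.le
  have hes : maxEssCount A B ≤ F.essCount := by
    obtain ⟨F', hF'⟩ := (maxEssCount_isGreatest A B).1
    exact hF' ▸ hF F'
  have hgk : ∀ j, k ≤ j → ctrbGenericRank A B j = maxEssCount A B := by
    intro j hj
    refine le_antisymm (ctrbGenericRank_le_maxEssCount A B j) (hes.trans ?_)
    refine le_trans (Finset.sum_le_sum fun i _ => ?_) (sum_min_le_ctrbGenericRank F j)
    exact le_min le_rfl ((hFk i).trans hj)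
  exact hleast.2 ⟨hk, hkn, by rw [hgk k le_rfl, hgk (k + 1) (Nat.le_succ k)]⟩

theorem min_sum_le_sum_min {ι : Type*} (S : Finset ι) (f : ι → ℕ) (k : ℕ) :
    min (∑ i ∈ S, f i) k ≤ ∑ i ∈ S, min (f i) k := by
  classical
  induction S using Finset.induction_on with
  | empty => simp
  | insert i S hi ih =>
    rw [Finset.sum_insert hi, Finset.sum_insert hi]
    omega

/-- With a single input the generic rank grows by one in every step until it reaches the maximum
number of essentially covered states. -/
theorem structuralControllabilityIndex_eq_maxEssCount {n : ℕ} (hn : 1 ≤ n)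
    {A : StructuredMatrix n n} {B : StructuredMatrix n 1} (hB : ∃ i, B i 0) :
    structuralControllabilityIndex A B = maxEssCount A B := by
  obtain ⟨i, hi⟩ := hB
  have hpos : 1 ≤ maxEssCount A B := maxEssCount_pos hi
  obtain ⟨F, hF⟩ := (maxEssCount_isGreatest A B).1
  apply le_antisymm
  · refine structuralControllabilityIndex_le_of_isMaximum hn hpos F (fun F' => ?_) fun i => ?_
    · exact hF ▸ (maxEssCount_isGreatest A B).2 ⟨F', rfl⟩
    · rw [← hF]
      exact Finset.single_le_sum (f := fun i => (F.member i).essCovered.card)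
        (fun _ _ => Nat.zero_le _) (Finset.mem_univ i)
  · by_contra hlt
    obtain ⟨-, -, hstall⟩ := (structuralControllabilityIndex_isLeast hn A B).1
    set k := structuralControllabilityIndex A B
    have hle : ctrbGenericRank A B k ≤ k := by
      obtain ⟨A', B', -, -, h⟩ := (ctrbRanks_isGreatest A B k).1
      rw [h]
      simpa using (ctrbMatrix k A' B').rank_le_card_width
    have hge := (min_sum_le_sum_min Finset.univ (fun i => (F.member i).essCovered.card)
      (k + 1)).trans (sum_min_le_ctrbGenericRank F (k + 1))
    have hsum : ∑ i, (F.member i).essCovered.card = maxEssCount A B := hF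
    rw [hsum] at hge
    omega

theorem theorem1 (n : ℕ) (hn : 1 ≤ n) (A : StructuredMatrix n n) :
    (∀ (m : ℕ) (B : StructuredMatrix n m) (k : ℕ), 1 ≤ k →
      (∃ F : CactusStructureFamily A B, F.IsMaximum ∧
        ∀ i, (F.member i).essCovered.card ≤ k) →
      structuralControllabilityIndex A B ≤ k) ∧
    (∀ B : StructuredMatrix n 1, (∃ i, B i 0) →
      structuralControllabilityIndex A B = maxEssCount A B) := by
  refine ⟨fun m B k hk ⟨F, hF, hFk⟩ => ?_, fun B hB => ?_⟩
  · exact structuralControllabilityIndex_le_of_isMaximum hn hk F hF hFk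
  · exact structuralControllabilityIndex_eq_maxEssCount hn hB
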